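/- Let $E$ be an elliptic curve over $\mathbb{Q}$ and let $p$ be a prime at which $E$ has good ordinary reduction; that is, the reduction of a minimal Weierstrass model of $E$ at $p$ is a nonsingular curve over $\mathbb{F}_p$ that has a point of order $p$ over $\overline{\mathbb{F}}_p$. For $n\ge 1$ let $\#E(\mathbb{F}_{p^n})$ be the number of points over $\mathbb{F}_{p^n}$ (including the point at infinity) of this reduction, and put $$a_n = p^n+1-\#E(\mathbb{F}_{p^n}),\qquad \alpha_n=\frac{a_n}{2p^{n/2}} .$$ Then the following hold. 1. There is $\theta\in[0,\pi]$ such that the two roots in $\mathbb{C}$, counted with multiplicity, of the characteristic polynomial of Frobenius $T^2-a_1T+p$ are $\tau=p^{1/2}e^{i\theta}$ and $\overline{\tau}$, and for every $n\ge 1$ $$a_n=\tau^n+\overline{\tau}^{\,n},\qquad \alpha_n=\frac{\tau^n+\overline{\tau}^{\,n}}{2p^{n/2}}=\cos(n\theta).$$ 2. The sequence $(\alpha_n)_{n\ge1}$ of normalized traces of Frobenius lies in $[-1,1]$ and is dense in $[-1,1]$. 3. The sequence $(\alpha_n)_{n\ge1}$ is not equidistributed on $[-1,1]$; that is, it is not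 true that for all $-1\le c\le d\le 1$ $$\lim_{N\to\infty}\frac{\#\{1\le n\le N:\alpha_n\in[c,d]\}}{N}=\frac{d-c}{2}.$$ -/

import Mathlib

noncomputable section

namespace FrobeniusTraces

/-- A minimal Weierstrass model at `p` of the curve `E` over the rational numbers, that is, a minimal
Weierstrass equation over the `p`-adic integers of `E` regarded over the `p`-adic numbers. -/
def minimalModel (E : WeierstrassCurve ℚ) (p : ℕ) [Fact p.Prime] : WeierstrassCurve ℚ_[p] :=
  (E.baseChange ℚ_[p]).minimal ℤ_[p]

instance (E : WeierstrassCurve ℚ) (p : ℕ) [Fact p.Prime] :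
    (minimalModel E p).IsMinimal ℤ_[p] :=
  inferInstanceAs (((E.baseChange ℚ_[p]).minimal ℤ_[p]).IsMinimal ℤ_[p])

/-- The reduction of `E` modulo `p`: the reduction of a minimal model at `p`, as a curve over the
field `ZMod p` with `p` elements. -/
def reductionMod (E : WeierstrassCurve ℚ) (p : ℕ) [Fact p.Prime] : WeierstrassCurve (ZMod p) :=
  ((minimalModel E p).reduction ℤ_[p]).map (PadicInt.residueField (p := p)).toRingHom

/-- A curve `W` over `ZMod p` is ordinary if it has a point of exact order `p` over an algebraic
closure of `ZMod p`. -/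
def IsOrdinary {p : ℕ} [Fact p.Prime] (W : WeierstrassCurve (ZMod p)) : Prop :=
  open Classical in
  ∃ P : (W.baseChange (AlgebraicClosure (ZMod p))).toAffine.Point, P ≠ 0 ∧ p • P = 0

/-- `E` has good ordinary reduction at `p`. -/
def HasGoodOrdinaryReduction (E : WeierstrassCurve ℚ) (p : ℕ) [Fact p.Prime] : Prop :=
  (minimalModel E p).HasGoodReduction ℤ_[p] ∧ IsOrdinary (reductionMod E p)

/-- The number of points of (the reduction modulo `p` of) `E` over the field with `p ^ n` elements,
the point at infinity included (for `n ≥ 1`). -/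
def pointCount (E : WeierstrassCurve ℚ) (p : ℕ) [Fact p.Prime] (n : ℕ) : ℕ :=
  Nat.card ((reductionMod E p).baseChange (GaloisField p n)).toAffine.Point

/-- The trace of Frobenius over the field with `p ^ n` elements. -/
def frobeniusTrace (E : WeierstrassCurve ℚ) (p : ℕ) [Fact p.Prime] (n : ℕ) : ℤ :=
  (p : ℤ) ^ n + 1 - (pointCount E p n : ℤ)

/-- The normalized trace of Frobenius. -/
def normalizedTrace (E : WeierstrassCurve ℚ) (p : ℕ) [Fact p.Prime] (n : ℕ) : ℝ :=
  (frobeniusTrace E p n : ℝ) / (2 * (p : ℝ) ^ ((n : ℝ) / 2))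

/-- The characteristic polynomial of the Frobenius of `E` at `p`, whose complex roots are
the Frobenius eigenvalues. -/
def frobeniusPolynomial (E : WeierstrassCurve ℚ) (p : ℕ) [Fact p.Prime] : Polynomial ℂ :=
  Polynomial.X ^ 2 - Polynomial.C (frobeniusTrace E p 1 : ℂ) * Polynomial.X + Polynomial.C (p : ℂ)

/-- The terms `u 1, u 2, …` of the sequence `u` lie in `[a, b]` and are dense there. -/
def IsDenseInInterval (u : ℕ → ℝ) (a b : ℝ) : Prop :=
  (∀ n, 1 ≤ n → u n ∈ Set.Icc a b) ∧ Set.Icc a b ⊆ closure (u '' {n | 1 ≤ n})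

/-- The sequence `u 1, u 2, …` is equidistributed on `[a, b]`: each subinterval `[c, d]` receives the
proportion `(d - c) / (b - a)` of the terms. -/
def IsEquidistributed (u : ℕ → ℝ) (a b : ℝ) : Prop :=
  open Classical in
  ∀ c d : ℝ, a ≤ c → c ≤ d → d ≤ b →
    Filter.Tendsto (fun N : ℕ => (((Finset.Icc 1 N).filter (fun n => u n ∈ Set.Icc c d)).card : ℝ) / N)
      Filter.atTop (nhds ((d - c) / (b - a)))

end FrobeniusTraces

end

/-! Let W be an elliptic curve over a field F with q elements, k an algebraically closed extension
of F, and K the function field of W over k. Odd points of W(K), those that the negation of the curve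
turns into their negatives, stand in for endomorphisms: the generic point e = (x, y) is the
identity, and raising coordinates to the power q is Frobenius φ. The abscissa of an odd point lies
in k(x); its degree d as a rational function replaces the degree of an endomorphism. The symmetric
functions of x(P + Q) and x(P - Q) are quadratic forms, without common zero, in those of x(P) and
x(Q), so d obeys the parallelogram law with no error term (`parallelogramLaw_oddDegree`). Moreover d
≥ 0, d(e) = 1 and d(φP) = q d(P).

Put b_n = ⟨φⁿe, e⟩ for the polar form of d. Substituting φe + e for the generic point in φe - e
gives φ²e - e, and degrees multiply under substitution (`oddDegree_frobenius_sq_sub`). This forces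
d(φ²e - b_1 φe + qe) = 0, so this point lies in the radical of the form, which yields the recurrence
for b_n; d(2φe - b_1 e) ≥ 0 is the Hasse bound. Finally qⁿ + 1 - b_n = d(φⁿe - e) is the number of
points over the extension of degree n, by counting the poles of the abscissa of φⁿe - e
(`oddDegree_frobeniusHom_iterate_sub`). The outcome is `exists_trace_sequence`.

Now take q = p, so that b_n is the n-th power sum of τ and its conjugate. A point of order p is
defined over some finite field, so p divides a point count p^n + 1 - b_n and does not divide that
b_n. Since b_n ≡ b_1^n mod p, p divides no b_n with n ≥ 1. If θ/(2π) were rational with denominator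
m, then b_{2m} = 2p^m, a contradiction. Irrational rotation gives density. Equidistribution would
make the mean of α_n² equal to 1/3, whereas the mean of cos²(nθ) is 1/2. -/

section EllipticCurves

open Polynomial WeierstrassCurve

/-! ### Coprime polynomial vectors as maps to projective space, and their degrees. -/

section PolynomialVectors

variable {k : Type*} [Field k]

/-- `f` has degree at most `D`, and `a` is its coefficient in degree `D`, that is, the value at
infinity of `f` regarded as a form of degree `D`. -/
def Polynomial.HasTop (f : k[X]) (D : ℕ) (a : k) : Prop :=
  f.natDegree ≤ D ∧ f.coeff D = a

namespace Polynomial.HasTop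

variable {f g : k[X]} {D E : ℕ} {a b : k}

lemma add (hf : f.HasTop D a) (hg : g.HasTop D b) : (f + g).HasTop D (a + b) :=
  ⟨natDegree_add_le_of_degree_le hf.1 hg.1, by rw [coeff_add, hf.2, hg.2]⟩

lemma sub (hf : f.HasTop D a) (hg : g.HasTop D b) : (f - g).HasTop D (a - b) :=
  ⟨natDegree_sub_le_of_le hf.1 hg.1 |>.trans (by simp), by rw [coeff_sub, hf.2, hg.2]⟩

lemma mul (hf : f.HasTop D a) (hg : g.HasTop E b) : (f * g).HasTop (D + E) (a * b) :=
  ⟨natDegree_mul_le_of_le hf.1 hg.1, by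
    rw [coeff_mul_add_eq_of_natDegree_le hf.1 hg.1, hf.2, hg.2]⟩

lemma C_mul (c : k) (hf : f.HasTop D a) : (C c * f).HasTop D (c * a) :=
  ⟨(natDegree_C_mul_le _ _).trans hf.1, by rw [coeff_C_mul, hf.2]⟩

lemma zero (D : ℕ) : (0 : k[X]).HasTop D 0 := ⟨by simp, by simp⟩

lemma pow (hf : f.HasTop D a) (n : ℕ) : (f ^ n).HasTop (n * D) (a ^ n) := by
  induction n with
  | zero => exact ⟨by simp, by simp⟩
  | succ n ih =>
    rw [pow_succ, pow_succ, Nat.succ_mul]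
    exact ih.mul hf

lemma sum {ι : Type*} (s : Finset ι) (f : ι → k[X]) (a : ι → k)
    (h : ∀ i ∈ s, (f i).HasTop D (a i)) : (∑ i ∈ s, f i).HasTop D (∑ i ∈ s, a i) := by
  classical
  induction s using Finset.induction_on with
  | empty => simpa using zero D
  | insert i s hi ih =>
    rw [Finset.sum_insert hi, Finset.sum_insert hi]
    exact (h i (by simp)).add (ih fun j hj ↦ h j (by simp [hj]))

end Polynomial.HasTop

/-- The maximal degree of the entries of a vector of polynomials. -/
def maxDegree {n : ℕ} (v : Fin n → k[X]) : ℕ :=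
  Finset.univ.sup fun i ↦ (v i).natDegree

/-- A vector of polynomials without common zero in `k`. -/
def HasNoCommonZero {n : ℕ} (v : Fin n → k[X]) : Prop :=
  ∀ a : k, ∃ i, (v i).eval a ≠ 0

lemma natDegree_le_maxDegree {n : ℕ} (v : Fin n → k[X]) (i : Fin n) :
    (v i).natDegree ≤ maxDegree v :=
  Finset.le_sup (f := fun i ↦ (v i).natDegree) (Finset.mem_univ i)

lemma hasTop_maxDegree {n : ℕ} (v : Fin n → k[X]) (i : Fin n) :
    (v i).HasTop (maxDegree v) ((v i).coeff (maxDegree v)) :=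
  ⟨natDegree_le_maxDegree v i, rfl⟩

/-- A nonzero value at infinity excludes cancellation of the top terms. All degree formulas below
come from this: a homogeneous map without nontrivial zeros keeps the value at infinity nonzero. -/
lemma maxDegree_eq {n : ℕ} {v : Fin n → k[X]} {D : ℕ} {a : Fin n → k}
    (h : ∀ i, (v i).HasTop D (a i)) (ha : a ≠ 0) : maxDegree v = D := by
  obtain ⟨i, hi⟩ := Function.ne_iff.mp ha
  refine le_antisymm (Finset.sup_le fun i _ ↦ (h i).1) ?_
  refine le_trans ?_ (natDegree_le_maxDegree v i)
  exact le_natDegree_of_ne_zero (by rw [(h i).2]; exact hi)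

lemma coeff_maxDegree_ne_zero {n : ℕ} {v : Fin n → k[X]} (hv : v ≠ 0) :
    (fun i ↦ (v i).coeff (maxDegree v)) ≠ 0 := by
  obtain ⟨i₀, hi₀⟩ := Function.ne_iff.mp hv
  obtain ⟨i, -, hi⟩ := Finset.exists_mem_eq_sup Finset.univ ⟨i₀, Finset.mem_univ _⟩
    (fun i ↦ (v i).natDegree)
  by_cases h0 : v i = 0
  · have hD : maxDegree v = 0 := by rw [maxDegree, hi, h0, natDegree_zero]
    refine Function.ne_iff.mpr ⟨i₀, ?_⟩
    have := natDegree_le_maxDegree v i₀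
    rw [hD, Nat.le_zero] at this
    rw [hD, ← this]
    simpa using hi₀
  · refine Function.ne_iff.mpr ⟨i, ?_⟩
    rw [maxDegree, hi]
    simpa using h0

lemma HasNoCommonZero.ne_zero {n : ℕ} {v : Fin n → k[X]} (hv : HasNoCommonZero v) : v ≠ 0 := by
  rintro rfl
  obtain ⟨i, hi⟩ := hv 0
  simp at hi

/-- A generator of this principal ideal divides every entry, so a root of it would be a common zero.
-/
lemma HasNoCommonZero.span_eq_top [IsAlgClosed k] {n : ℕ} {v : Fin n → k[X]}
    (hv : HasNoCommonZero v) : Ideal.span (Set.range v) = ⊤ := by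
  obtain ⟨g, hg⟩ := IsPrincipalIdealRing.principal (Ideal.span (Set.range v))
  rw [Ideal.submodule_span_eq] at hg
  have hdvd (i) : g ∣ v i := by
    rw [← Ideal.mem_span_singleton, ← hg]
    exact Ideal.subset_span ⟨i, rfl⟩
  rw [hg, Ideal.span_singleton_eq_top]
  by_contra hu
  have : ∃ a, g.eval a = 0 := by
    by_cases h0 : g = 0
    · exact ⟨0, by simp [h0]⟩
    · refine IsAlgClosed.exists_root g fun hd ↦ hu ?_
      exact isUnit_iff_degree_eq_zero.mpr hd
  obtain ⟨a, ha⟩ := this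
  obtain ⟨i, hi⟩ := hv a
  exact hi (eval_eq_zero_of_dvd_of_eval_eq_zero (hdvd i) ha)

/-- Proportional vectors of polynomials without common zeros differ by a constant factor. -/
lemma HasNoCommonZero.exists_eq_C_mul [IsAlgClosed k] {n : ℕ} {u v : Fin n → k[X]}
    (hu : HasNoCommonZero u) (hv : HasNoCommonZero v) (h : ∀ i j, u i * v j = u j * v i) :
    ∃ c : k, c ≠ 0 ∧ ∀ j, v j = C c * u j := by
  have h1 : (1 : k[X]) ∈ Ideal.span (Set.range u) := by rw [hu.span_eq_top]; trivial
  obtain ⟨a, ha⟩ := (Ideal.mem_span_range_iff_exists_fun).mp h1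
  have hw (j) : v j = (∑ i, a i * v i) * u j := by
    rw [← one_mul (v j), ← ha, Finset.sum_mul, Finset.sum_mul]
    exact Finset.sum_congr rfl fun i _ ↦ by rw [mul_assoc, h i j]; ring
  have hd : (∑ i, a i * v i).degree = 0 := by
    by_contra hd
    obtain ⟨x, hx⟩ := IsAlgClosed.exists_root _ hd
    obtain ⟨i, hi⟩ := hv x
    rw [hw, eval_mul, hx.eq_zero, zero_mul] at hi
    exact hi rfl
  rw [eq_C_of_degree_eq_zero hd] at hw
  refine ⟨_, ?_, hw⟩
  intro h0
  obtain ⟨i, hi⟩ := hv 0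
  rw [hw, h0] at hi
  simp at hi

lemma maxDegree_C_mul {n : ℕ} {u v : Fin n → k[X]} {c : k} (hc : c ≠ 0)
    (h : ∀ j, v j = C c * u j) : maxDegree v = maxDegree u := by
  unfold maxDegree
  congr 1
  ext j
  rw [h, natDegree_C_mul hc]

/-- The symmetric square of a pair of homogeneous coordinate vectors. -/
def symSq {R : Type*} [CommRing R] (u v : Fin 2 → R) : Fin 3 → R :=
  ![u 0 * v 0, u 0 * v 1 + u 1 * v 0, u 1 * v 1]

lemma symSq_ne_zero {u v : Fin 2 → k} (hu : u ≠ 0) (hv : v ≠ 0) : symSq u v ≠ 0 := by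
  intro h
  have h0 : u 0 * v 0 = 0 := congrFun h 0
  have h1 : u 0 * v 1 + u 1 * v 0 = 0 := congrFun h 1
  have h2 : u 1 * v 1 = 0 := congrFun h 2
  have hu' : u 0 ≠ 0 ∨ u 1 ≠ 0 := by
    by_contra! h; exact hu (by ext i; fin_cases i <;> simp [h])
  have hv' : v 0 ≠ 0 ∨ v 1 ≠ 0 := by
    by_contra! h; exact hv (by ext i; fin_cases i <;> simp [h])
  grind

lemma map_symSq {R S : Type*} [CommRing R] [CommRing S] (φ : R →+* S) (u v : Fin 2 → R)
    (i : Fin 3) : φ (symSq u v i) = symSq (fun j ↦ φ (u j)) (fun j ↦ φ (v j)) i := by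
  fin_cases i <;> simp [symSq]

lemma HasNoCommonZero.symSq {u v : Fin 2 → k[X]} (hu : HasNoCommonZero u)
    (hv : HasNoCommonZero v) : HasNoCommonZero (symSq u v) := by
  intro a
  have := symSq_ne_zero (u := fun i ↦ (u i).eval a) (v := fun i ↦ (v i).eval a)
    (Function.ne_iff.mpr (hu a)) (Function.ne_iff.mpr (hv a))
  obtain ⟨i, hi⟩ := Function.ne_iff.mp this
  refine ⟨i, ?_⟩
  rw [← coe_evalRingHom, map_symSq]
  exact hi

lemma hasTop_symSq {u v : Fin 2 → k[X]} {D E : ℕ} {a b : Fin 2 → k}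
    (hu : ∀ i, (u i).HasTop D (a i)) (hv : ∀ i, (v i).HasTop E (b i)) (i : Fin 3) :
    (symSq u v i).HasTop (D + E) (symSq a b i) := by
  fin_cases i
  · exact (hu 0).mul (hv 0)
  · exact ((hu 0).mul (hv 1)).add ((hu 1).mul (hv 0))
  · exact (hu 1).mul (hv 1)

lemma maxDegree_symSq {u v : Fin 2 → k[X]} (hu : u ≠ 0) (hv : v ≠ 0) :
    maxDegree (symSq u v) = maxDegree u + maxDegree v :=
  maxDegree_eq (hasTop_symSq (hasTop_maxDegree u) (hasTop_maxDegree v))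
    (symSq_ne_zero (coeff_maxDegree_ne_zero hu) (coeff_maxDegree_ne_zero hv))

end PolynomialVectors

/-! ### The quadratic map from x(P), x(Q) to x(P + Q), x(P - Q). -/

section AddSub

/-- The values of the addition-and-subtraction map on symmetric squares of `x`-coordinates. -/
noncomputable def addSubVec {R : Type*} [CommRing R] (W : WeierstrassCurve R) (v : Fin 3 → R) :
    Fin 3 → R :=
  ![v 0 ^ 2 - W.b₄ * (v 0 * v 2) - W.b₆ * (v 1 * v 2) - W.b₈ * v 2 ^ 2,
    2 * (v 1 * v 0) + W.b₂ * (v 0 * v 2) + W.b₄ * (v 1 * v 2) + W.b₆ * v 2 ^ 2,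
    v 1 ^ 2 - 4 * (v 0 * v 2)]

lemma addSubVec_ne_zero {R : Type*} [CommRing R] [IsReduced R] (W : WeierstrassCurve R)
    [W.IsElliptic] {v : Fin 3 → R} (hv : v ≠ 0) : addSubVec W v ≠ 0 := by
  convert W.addSubMap_ne_zero hv using 1
  ext i
  fin_cases i <;> simp [addSubVec, addSubMap] <;> ring

lemma map_addSubVec {R S : Type*} [CommRing R] [CommRing S] (W : WeierstrassCurve R)
    (φ : R →+* S) (v : Fin 3 → R) (i : Fin 3) :
    φ (addSubVec W v i) = addSubVec (W.map φ) (fun j ↦ φ (v j)) i := by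
  fin_cases i <;> simp [addSubVec, map_ofNat φ]

/-- The coefficients of the forms are constants, so evaluation at a point reduces to nondegeneracy
over the field. -/
lemma HasNoCommonZero.addSubVec {k : Type*} [Field k] (W : WeierstrassCurve k) [W.IsElliptic]
    {v : Fin 3 → k[X]} (hv : HasNoCommonZero v) : HasNoCommonZero (addSubVec (W.map C) v) := by
  intro a
  have := addSubVec_ne_zero W (v := fun i ↦ (v i).eval a) (Function.ne_iff.mpr (hv a))
  obtain ⟨i, hi⟩ := Function.ne_iff.mp this
  refine ⟨i, ?_⟩
  rw [← coe_evalRingHom, map_addSubVec, WeierstrassCurve.map_map]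
  have : (W.map C).map (evalRingHom a) = W := by ext <;> simp
  rw [WeierstrassCurve.map_map] at this
  rw [this]
  exact hi

lemma hasTop_addSubVec {k : Type*} [Field k] (W : WeierstrassCurve k)
    {v : Fin 3 → k[X]} {D : ℕ} {a : Fin 3 → k} (h : ∀ i, (v i).HasTop D (a i)) (i : Fin 3) :
    (addSubVec (W.map C) v i).HasTop (2 * D) (addSubVec W a i) := by
  have h2 (i j) : (v i * v j).HasTop (2 * D) (a i * a j) := two_mul D ▸ (h i).mul (h j)
  have h2C : (2 : k[X]) = C 2 := (map_ofNat C 2).symm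
  have h4C : (4 : k[X]) = C 4 := (map_ofNat C 4).symm
  have hs (i) : (v i ^ 2).HasTop (2 * D) (a i ^ 2) := (h i).pow 2
  fin_cases i
  · simpa [addSubVec] using ((hs 0).sub ((h2 0 2).C_mul W.b₄)).sub ((h2 1 2).C_mul W.b₆) |>.sub
      ((hs 2).C_mul W.b₈)
  · simpa [addSubVec, h2C] using (((h2 1 0).C_mul 2).add ((h2 0 2).C_mul W.b₂)).add
      ((h2 1 2).C_mul W.b₄) |>.add ((hs 2).C_mul W.b₆)
  · simpa [addSubVec, h4C] using (hs 1).sub ((h2 0 2).C_mul 4)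

lemma maxDegree_addSubVec {k : Type*} [Field k] (W : WeierstrassCurve k) [W.IsElliptic]
    {v : Fin 3 → k[X]} (hv : v ≠ 0) : maxDegree (addSubVec (W.map C) v) = 2 * maxDegree v :=
  maxDegree_eq (hasTop_addSubVec W (hasTop_maxDegree v))
    (addSubVec_ne_zero W (coeff_maxDegree_ne_zero hv))

/-- The addition-and-subtraction map computes the `x`-coordinates of `P + Q` and `P - Q`. -/
lemma exists_addSubVec_eq {K : Type*} [Field K] [DecidableEq K] {W : WeierstrassCurve K}
    (P Q : W.toAffine.Point) :
    ∃ c : K, addSubVec W (symSq P.xRep Q.xRep) = c • symSq (P + Q).xRep (P - Q).xRep := by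
  have hdouble (P : W.toAffine.Point) :
      ∃ c : K, addSubVec W (symSq P.xRep P.xRep) = c • symSq (P + P).xRep (0 : W.toAffine.Point).xRep := by
    rcases P with _ | ⟨x, y, h⟩
    · refine ⟨1, ?_⟩
      change addSubVec W (symSq (0 : W.toAffine.Point).xRep (0 : W.toAffine.Point).xRep) =
        (1 : K) • symSq ((0 : W.toAffine.Point) + (0 : W.toAffine.Point)).xRep _
      rw [add_zero]
      ext i; fin_cases i <;> simp [addSubVec, symSq]
    · have heq := (Affine.equation_iff ..).mp h.1
      by_cases hy : y = W.toAffine.negY x y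
      · rw [Affine.Point.add_self_of_Y_eq hy]
        -- Here 2P = 0 and the constant is the numerator of the duplication formula. The middle
        -- coordinate 4x³ + b₂x² + 2b₄x + b₆ equals (2y + a₁x + a₃)² on the curve and vanishes.
        refine ⟨x ^ 4 - W.b₄ * x ^ 2 - 2 * W.b₆ * x - W.b₈, ?_⟩
        rw [Affine.negY] at hy
        ext i
        fin_cases i
        · simp [addSubVec, symSq]; ring
        · simp [addSubVec, symSq, b₂, b₄, b₆, b₈]; 
          linear_combination (-4) * heq + (2 * y + W.a₁ * x + W.a₃) * hy
        · simp [addSubVec, symSq]; ring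
      · rw [Affine.Point.add_self_of_Y_ne hy]
        refine ⟨(y - W.toAffine.negY x y) ^ 2, ?_⟩
        have hℓ : W.toAffine.slope x x y y * (y - W.toAffine.negY x y) =
            3 * x ^ 2 + 2 * W.a₂ * x + W.a₄ - W.a₁ * y := by
          rw [Affine.slope_of_Y_ne rfl hy, div_mul_cancel₀ _ (sub_ne_zero.mpr hy)]
        generalize_proofs hns
        generalize W.toAffine.slope x x y y = ℓ at *
        rw [Affine.negY] at hℓ
        ext i
        fin_cases i
        · simp [addSubVec, symSq, b₂, b₄, b₆, b₈]
          grind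
        · simp [addSubVec, symSq, b₂, b₄, b₆, b₈]
          linear_combination (-4) * heq
        · simp [addSubVec, symSq]; ring
  rcases P with _ | ⟨x₁, y₁, h₁⟩
  · change ∃ c : K, addSubVec W (symSq (0 : W.toAffine.Point).xRep Q.xRep) = c •
      symSq (0 + Q).xRep (0 - Q).xRep
    refine ⟨1, ?_⟩
    rw [zero_add, zero_sub, Affine.Point.xRep_neg]
    rcases Q with _ | ⟨x, y, h⟩
    · ext i; fin_cases i <;> simp [addSubVec, symSq, Affine.Point.xRep]
    · ext i; fin_cases i <;> simp [addSubVec, symSq] <;> ring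
  · rcases Q with _ | ⟨x₂, y₂, h₂⟩
    · refine ⟨1, ?_⟩
      change addSubVec W (symSq (Affine.Point.some x₁ y₁ h₁).xRep (0 : W.toAffine.Point).xRep) =
        (1 : K) • symSq (Affine.Point.some x₁ y₁ h₁ + 0).xRep (Affine.Point.some x₁ y₁ h₁ - 0).xRep
      rw [add_zero, sub_zero]
      ext i; fin_cases i <;> simp [addSubVec, symSq] <;> ring
    · by_cases hx : x₁ = x₂
      · subst hx
        rcases Affine.Point.X_eq_iff.mp (rfl : x₁ = x₁) with h | h
        · rw [h, sub_self]
          exact hdouble _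
        · obtain ⟨c, hc⟩ := hdouble (Affine.Point.some x₁ y₂ h₂)
          refine ⟨c, ?_⟩
          rw [h, Affine.Point.xRep_neg, hc, neg_add_cancel, ← neg_add', Affine.Point.xRep_neg]
          congr 1
          ext i; fin_cases i <;> simp [symSq]
      · have e₁ := (Affine.equation_iff ..).mp h₁.1
        have e₂ := (Affine.equation_iff ..).mp h₂.1
        have hx' := sub_ne_zero.mpr hx
        -- The constant is read off from the last coordinate, (x₁ + x₂)² - 4x₁x₂.
        refine ⟨(x₁ - x₂) ^ 2, ?_⟩
        rw [sub_eq_add_neg (Affine.Point.some x₁ y₁ h₁), Affine.Point.neg_some, Affine.Point.add_of_X_ne hx,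
          Affine.Point.add_of_X_ne hx]
        have hℓ : W.toAffine.slope x₁ x₂ y₁ y₂ * (x₁ - x₂) = y₁ - y₂ := by
          rw [Affine.slope_of_X_ne hx, div_mul_cancel₀ _ hx']
        have hm : W.toAffine.slope x₁ x₂ y₁ (W.toAffine.negY x₂ y₂) * (x₁ - x₂) =
            y₁ - W.toAffine.negY x₂ y₂ := by
          rw [Affine.slope_of_X_ne hx, div_mul_cancel₀ _ hx']
        generalize_proofs hns1 hns2
        generalize W.toAffine.slope x₁ x₂ y₁ y₂ = ℓ at *
        generalize W.toAffine.slope x₁ x₂ y₁ (W.toAffine.negY x₂ y₂) = m at *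
        rw [Affine.negY] at hm
        ext i
        fin_cases i
        · simp [addSubVec, symSq, b₂, b₄, b₆, b₈]
          -- One more factor (x₁ - x₂)² clears the denominators of both slopes, leaving a polynomial
          -- identity modulo the two curve equations.
          refine mul_left_cancel₀ (pow_ne_zero 2 hx') ?_
          have h3 : (x₁ - x₂) ^ 2 * (ℓ ^ 2 + W.a₁ * ℓ - W.a₂ - x₁ - x₂) =
              (y₁ - y₂) ^ 2 + W.a₁ * (y₁ - y₂) * (x₁ - x₂) -
                (W.a₂ + x₁ + x₂) * (x₁ - x₂) ^ 2 := by
            rw [← hℓ]; ring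
          have h4 : (x₁ - x₂) ^ 2 * (m ^ 2 + W.a₁ * m - W.a₂ - x₁ - x₂) =
              (y₁ - (-y₂ - W.a₁ * x₂ - W.a₃)) ^ 2 +
                W.a₁ * (y₁ - (-y₂ - W.a₁ * x₂ - W.a₃)) * (x₁ - x₂) -
                (W.a₂ + x₁ + x₂) * (x₁ - x₂) ^ 2 := by
            rw [← hm]; ring
          trans ((x₁ - x₂) ^ 2 * (ℓ ^ 2 + W.a₁ * ℓ - W.a₂ - x₁ - x₂)) *
            ((x₁ - x₂) ^ 2 * (m ^ 2 + W.a₁ * m - W.a₂ - x₁ - x₂))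
          · rw [h3, h4]
            clear h3 h4 hℓ hm
            grind
          · ring
        · simp [addSubVec, symSq, b₂, b₄, b₆, b₈]
          grind
        · simp [addSubVec, symSq]; ring

end AddSub

/-! ### Quadratic forms on commutative groups, with a similitude. -/

section QuadraticFunctions

/-- The parallelogram law for an integer-valued function on a commutative group. -/
def ParallelogramLaw {G : Type*} [AddCommGroup G] (d : G → ℤ) : Prop :=
  ∀ x y, d (x + y) + d (x - y) = 2 * d x + 2 * d y

namespace ParallelogramLaw

variable {G : Type*} [AddCommGroup G] {d : G → ℤ}

lemma map_zero (hd : ParallelogramLaw d) : d 0 = 0 := by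
  have := hd 0 0
  rw [add_zero, sub_zero] at this
  omega

/-- The bilinear map associated with a function that satisfies the parallelogram law. -/
def polarHom (hd : ParallelogramLaw d) (z : G) : G →+ ℤ where
  toFun x := d (x + z) - d x - d z
  map_zero' := by rw [zero_add, hd.map_zero]; ring
  map_add' x y := by
    have h1 := hd (x + z) y
    have h2 := hd (x - y) z
    have h3 := hd x (y + z)
    have h4 := hd x y
    rw [show x + z - y = x - y + z by abel] at h1
    rw [show x - (y + z) = x - y - z by abel] at h3
    rw [show x + z + y = x + y + z by abel] at h1
    rw [show x + (y + z) = x + y + z by abel] at h3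
    linarith

lemma polarHom_apply (hd : ParallelogramLaw d) (x z : G) :
    hd.polarHom z x = d (x + z) - d x - d z := rfl

lemma polarHom_comm (hd : ParallelogramLaw d) (x z : G) :
    hd.polarHom z x = hd.polarHom x z := by
  rw [polarHom_apply, polarHom_apply, add_comm]
  ring

lemma polarHom_self (hd : ParallelogramLaw d) (x : G) : hd.polarHom x x = 2 * d x := by
  have := hd x x
  rw [sub_self, hd.map_zero] at this
  rw [polarHom_apply]
  omega

lemma map_add (hd : ParallelogramLaw d) (x y : G) :
    d (x + y) = d x + d y + hd.polarHom y x := by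
  rw [polarHom_apply]; ring

lemma map_sub (hd : ParallelogramLaw d) (x y : G) :
    d (x - y) = d x + d y - hd.polarHom y x := by
  have := hd x y
  rw [polarHom_apply]; linarith

lemma two_mul_map (hd : ParallelogramLaw d) (x : G) : 2 * d x = hd.polarHom x x :=
  (hd.polarHom_self x).symm

lemma map_zsmul (hd : ParallelogramLaw d) (m : ℤ) (x : G) : d (m • x) = m ^ 2 * d x := by
  have h : 2 * d (m • x) = 2 * (m ^ 2 * d x) := by
    rw [hd.two_mul_map, _root_.map_zsmul, polarHom_comm, _root_.map_zsmul, hd.polarHom_self]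
    simp only [smul_eq_mul]; ring
  linarith

/-- The value of d at m x + y is affine in m when d x = 0, and an affine function that is
nonnegative on all integers has slope zero. -/
lemma polarHom_eq_zero (hd : ParallelogramLaw d) (h0 : ∀ x, 0 ≤ d x) {x : G} (hx : d x = 0)
    (y : G) : hd.polarHom y x = 0 := by
  have key (m : ℤ) : 0 ≤ d y + m * hd.polarHom y x := by
    have := h0 (m • x + y)
    rw [hd.map_add, hd.map_zsmul, hx, _root_.map_zsmul, smul_eq_mul] at this
    linarith
  by_contra hne
  have h1 := key (-(d y + 1) * hd.polarHom y x)
  have h2 : 1 ≤ hd.polarHom y x ^ 2 := by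
    have : 0 < hd.polarHom y x ^ 2 := by positivity
    omega
  nlinarith [h0 y]

lemma polarHom_zsmul (hd : ParallelogramLaw d) (m : ℤ) (x y : G) :
    hd.polarHom (m • y) x = m * hd.polarHom y x := by
  rw [polarHom_comm, _root_.map_zsmul, polarHom_comm, smul_eq_mul]

variable {q : ℤ} {φ : G →+ G} {e : G}

lemma polarHom_map (hd : ParallelogramLaw d) (hφ : ∀ x, d (φ x) = q * d x) (x y : G) :
    hd.polarHom (φ y) (φ x) = q * hd.polarHom y x := by
  rw [polarHom_apply, polarHom_apply, ← _root_.map_add, hφ, hφ, hφ]; ring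

/-- A similitude `φ` of multiplier `q` with `d (φ² e - e) = d (φ e - e) d (φ e + e)` satisfies
a quadratic equation on the cyclic module generated by `e`, as far as `d` can tell. -/
lemma map_charpoly_eq_zero (hd : ParallelogramLaw d) (hφ : ∀ x, d (φ x) = q * d x)
    (he : d e = 1) (h2 : d (φ (φ e) - e) = d (φ e - e) * d (φ e + e)) :
    d (φ (φ e) - (hd.polarHom e (φ e)) • φ e + q • e) = 0 := by
  -- With t = ⟨φe, e⟩ the hypothesis becomes q² + 1 - ⟨φ²e, e⟩ = (q + 1)² - t², that is, ⟨φ²e, e⟩ =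
  -- t² - 2q.
  rw [hd.map_sub, hd.map_sub, hd.map_add, hφ, hφ, he] at h2
  have h12 : hd.polarHom (φ e) (φ (φ e)) = q * hd.polarHom e (φ e) := hd.polarHom_map hφ _ _
  rw [hd.map_add, hd.map_sub, hd.map_zsmul, hd.map_zsmul, hφ, hφ, he, hd.polarHom_zsmul,
    hd.polarHom_zsmul, _root_.map_sub, _root_.map_zsmul, h12, smul_eq_mul]
  linear_combination (-q) * h2

/-- The characteristic equation holds modulo the radical of the form, and φ preserves the vanishing
of d; pairing its iterates with e gives the recurrence. -/
lemma polarHom_recurrence (hd : ParallelogramLaw d) (h0 : ∀ x, 0 ≤ d x)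
    (hφ : ∀ x, d (φ x) = q * d x)
    (he : d e = 1) (h2 : d (φ (φ e) - e) = d (φ e - e) * d (φ e + e)) (n : ℕ) :
    hd.polarHom e (φ^[n + 2] e) =
      hd.polarHom e (φ e) * hd.polarHom e (φ^[n + 1] e) - q * hd.polarHom e (φ^[n] e) := by
  set v := φ (φ e) - (hd.polarHom e (φ e)) • φ e + q • e with hv
  have hvn (n : ℕ) : d (φ^[n] v) = 0 := by
    induction n with
    | zero => exact hd.map_charpoly_eq_zero hφ he h2
    | succ n ih => rw [Function.iterate_succ_apply', hφ, ih, mul_zero]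
  have h := hd.polarHom_eq_zero h0 (hvn n) e
  rw [hv, iterate_map_add, iterate_map_sub, iterate_map_zsmul, iterate_map_zsmul, _root_.map_add,
    _root_.map_sub, _root_.map_zsmul, _root_.map_zsmul, ← Function.iterate_succ_apply,
    ← Function.iterate_succ_apply, ← Function.iterate_succ_apply, smul_eq_mul, smul_eq_mul] at h
  linarith

/-- With t = ⟨φe, e⟩, the value of d at 2φe - te is 4q - t². This is the Hasse bound. -/
lemma sq_polarHom_le (hd : ParallelogramLaw d) (h0 : ∀ x, 0 ≤ d x)
    (hφ : ∀ x, d (φ x) = q * d x) (he : d e = 1) :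
    hd.polarHom e (φ e) ^ 2 ≤ 4 * q := by
  have := h0 ((2 : ℤ) • φ e - (hd.polarHom e (φ e)) • e)
  rw [hd.map_sub, hd.map_zsmul, hd.map_zsmul, hφ, he, _root_.map_zsmul,
    hd.polarHom_zsmul] at this
  simp only [smul_eq_mul] at this
  linarith

lemma map_iterate_sub (hd : ParallelogramLaw d) (hφ : ∀ x, d (φ x) = q * d x) (he : d e = 1)
    (n : ℕ) : d (φ^[n] e - e) = q ^ n + 1 - hd.polarHom e (φ^[n] e) := by
  have : d (φ^[n] e) = q ^ n := by
    induction n with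
    | zero => simpa using he
    | succ n ih => rw [Function.iterate_succ_apply', hφ, ih]; ring
  rw [hd.map_sub, this, he]

end ParallelogramLaw

end QuadraticFunctions

/-! ### The degree of an abscissa as a height. -/

section Heights

variable {F : Type*} [Field F] {W : WeierstrassCurve F} 
  {k : Type*} [Field k]
  {K : Type*} [Field K] [Algebra F K] [Algebra k[X] K]

lemma symSq_smul {R : Type*} [CommRing R] (a b : R) (u v : Fin 2 → R) :
    symSq (a • u) (b • v) = (a * b) • symSq u v := by
  ext i
  fin_cases i <;> simp [symSq] <;> ring

lemma addSubVec_smul {R : Type*} [CommRing R] (W : WeierstrassCurve R) (a : R) (v : Fin 3 → R) :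
    addSubVec W (a • v) = a ^ 2 • addSubVec W v := by
  ext i
  fin_cases i <;> simp [addSubVec] <;> ring

/-- The coprime polynomials `u 0`, `u 1` are homogeneous coordinates of the `x`-coordinate of the
point `P`. -/
def IsXRep (P : (W⁄K).toAffine.Point) (u : Fin 2 → k[X]) : Prop :=
  HasNoCommonZero u ∧
    algebraMap k[X] K (u 0) * P.xRep 1 = algebraMap k[X] K (u 1) * P.xRep 0

variable [FaithfulSMul k[X] K]

lemma IsXRep.exists_smul_eq {P : (W⁄K).toAffine.Point} {u : Fin 2 → k[X]} (h : IsXRep P u) :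
    ∃ c : K, c ≠ 0 ∧ (fun i ↦ algebraMap k[X] K (u i)) = c • P.xRep := by
  have hinj := FaithfulSMul.algebraMap_injective k[X] K
  obtain ⟨h1, h2⟩ := h
  have hne := h1.ne_zero
  have hu : ¬ (u 0 = 0 ∧ u 1 = 0) := fun h ↦ hne (by ext1 i; fin_cases i <;> simp [h])
  rcases P with _ | ⟨x, y, hxy⟩
  · change _ * 0 = _ * 1 at h2
    rw [mul_zero, mul_one, eq_comm, map_eq_zero_iff _ hinj] at h2
    refine ⟨algebraMap k[X] K (u 0), ?_, ?_⟩
    · rw [Ne, map_eq_zero_iff _ hinj]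
      exact fun h0 ↦ hu ⟨h0, h2⟩
    · change _ = _ • ![1, 0]
      ext i; fin_cases i <;> simp [h2]
  · change _ * 1 = _ * x at h2
    refine ⟨algebraMap k[X] K (u 1), ?_, ?_⟩
    · intro h0
      rw [h0, zero_mul, mul_one, map_eq_zero_iff _ hinj] at h2
      rw [map_eq_zero_iff _ hinj] at h0
      exact hu ⟨h2, h0⟩
    · change _ = _ • ![x, 1]
      ext i; fin_cases i <;> simp [← h2]

variable [IsAlgClosed k]

lemma IsXRep.maxDegree_eq {P : (W⁄K).toAffine.Point} {u v : Fin 2 → k[X]} (hu : IsXRep P u)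
    (hv : IsXRep P v) : maxDegree u = maxDegree v := by
  have hinj := FaithfulSMul.algebraMap_injective k[X] K
  obtain ⟨a, ha, hau⟩ := hu.exists_smul_eq
  obtain ⟨b, hb, hbv⟩ := hv.exists_smul_eq
  obtain ⟨c, hc, h⟩ := hu.1.exists_eq_C_mul hv.1 fun i j ↦ hinj <| by
    have h1 (i) : algebraMap k[X] K (u i) = a * P.xRep i := congrFun hau i
    have h2 (i) : algebraMap k[X] K (v i) = b * P.xRep i := congrFun hbv i
    rw [map_mul, map_mul, h1, h1, h2, h2]; ring
  exact (maxDegree_C_mul hc h).symm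

/-- Both vectors are proportional over K to the symmetric square of x(P + Q) and x(P - Q), and both
are without common zero, so the factor is a constant. Taking degrees gives the parallelogram law. -/
lemma IsXRep.addSubVec_eq [DecidableEq K] [Algebra F k] [IsScalarTower F k[X] K] [W.IsElliptic] {P Q : (W⁄K).toAffine.Point} {u₁ u₂ u₃ u₄ : Fin 2 → k[X]}
    (h₁ : IsXRep P u₁) (h₂ : IsXRep Q u₂) (h₃ : IsXRep (P + Q) u₃) (h₄ : IsXRep (P - Q) u₄) :
    ∃ c : k, c ≠ 0 ∧ ∀ i, addSubVec ((W⁄k).map C) (symSq u₁ u₂) i = C c * symSq u₃ u₄ i := by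
  have hinj := FaithfulSMul.algebraMap_injective k[X] K
  obtain ⟨c₁, hc₁, e₁⟩ := h₁.exists_smul_eq
  obtain ⟨c₂, hc₂, e₂⟩ := h₂.exists_smul_eq
  obtain ⟨c₃, hc₃, e₃⟩ := h₃.exists_smul_eq
  obtain ⟨c₄, hc₄, e₄⟩ := h₄.exists_smul_eq
  have hell : (W⁄k).IsElliptic := inferInstanceAs (W.map _).IsElliptic
  refine (h₃.1.symSq h₄.1).exists_eq_C_mul ((h₁.1.symSq h₂.1).addSubVec (W⁄k))
    fun i j ↦ hinj ?_
  obtain ⟨c, hc⟩ := exists_addSubVec_eq P Q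
  have hW : ((W⁄k).map C).map (algebraMap k[X] K) = W⁄K := by
    rw [WeierstrassCurve.map_map, baseChange, baseChange, WeierstrassCurve.map_map]
    congr 1
    rw [IsScalarTower.algebraMap_eq F k[X] K, RingHom.comp_assoc]
    rfl
  have hs (i) : algebraMap k[X] K (symSq u₃ u₄ i) =
      (c₃ * c₄) * symSq (P + Q).xRep (P - Q).xRep i := by
    rw [map_symSq, e₃, e₄, symSq_smul]; rfl
  have ha (i) : algebraMap k[X] K (addSubVec ((W⁄k).map C) (symSq u₁ u₂) i) =
      (c₁ * c₂) ^ 2 * (c * symSq (P + Q).xRep (P - Q).xRep i) := by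
    simp_rw [map_addSubVec, map_symSq, e₁, e₂, symSq_smul, hW]
    change addSubVec _ ((c₁ * c₂) • symSq P.xRep Q.xRep) i = _
    rw [addSubVec_smul, hc]; rfl
  rw [map_mul, map_mul, hs, hs, ha, ha]
  ring

lemma IsXRep.maxDegree_add [DecidableEq K] [Algebra F k] [IsScalarTower F k[X] K] [W.IsElliptic] {P Q : (W⁄K).toAffine.Point}
    {u₁ u₂ u₃ u₄ : Fin 2 → k[X]}
    (h₁ : IsXRep P u₁) (h₂ : IsXRep Q u₂) (h₃ : IsXRep (P + Q) u₃) (h₄ : IsXRep (P - Q) u₄) :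
    maxDegree u₃ + maxDegree u₄ = 2 * maxDegree u₁ + 2 * maxDegree u₂ := by
  obtain ⟨c, hc, h⟩ := h₁.addSubVec_eq h₂ h₃ h₄
  have hell : (W⁄k).IsElliptic := inferInstanceAs (W.map _).IsElliptic
  rw [← maxDegree_symSq h₃.1.ne_zero h₄.1.ne_zero, ← maxDegree_C_mul hc h,
    maxDegree_addSubVec _ (h₁.1.symSq h₂.1).ne_zero, maxDegree_symSq h₁.1.ne_zero h₂.1.ne_zero,
    mul_add]

variable (k) in
open scoped Classical in
/-- The degree of the `x`-coordinate of a point as a rational function. -/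
noncomputable def xDegree (P : (W⁄K).toAffine.Point) : ℕ :=
  if h : ∃ u : Fin 2 → k[X], IsXRep P u then maxDegree h.choose else 0

lemma IsXRep.xDegree_eq {P : (W⁄K).toAffine.Point} {u : Fin 2 → k[X]} (h : IsXRep P u) :
    xDegree k P = maxDegree u := by
  have h' : ∃ u : Fin 2 → k[X], IsXRep P u := ⟨u, h⟩
  rw [xDegree, dif_pos h']
  exact h'.choose_spec.maxDegree_eq h

end Heights

/-! ### The function field and its negation automorphism. -/

section FunctionField

open scoped Polynomial.Bivariate

variable {k : Type*} [Field k] (W : WeierstrassCurve k)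

namespace WeierstrassCurve.Affine

lemma equation_baseChange_iff {R A : Type*} [CommRing R] [CommRing A] [Algebra R A]
    (W : WeierstrassCurve R) (u v : A) : (W⁄A).toAffine.Equation u v ↔
      v ^ 2 + algebraMap R A W.a₁ * u * v + algebraMap R A W.a₃ * v =
        u ^ 3 + algebraMap R A W.a₂ * u ^ 2 + algebraMap R A W.a₄ * u + algebraMap R A W.a₆ :=
  equation_iff ..

instance : Module.Finite k[X] W.toAffine.CoordinateRing :=
  .of_basis (CoordinateRing.basis W.toAffine)

/-- The cofactor is the conjugate of s over k[X], and the product is the norm. -/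
lemma CoordinateRing.exists_mul_eq_algebraMap {s : W.toAffine.CoordinateRing} (hs : s ≠ 0) :
    ∃ (t : W.toAffine.CoordinateRing) (N : k[X]), N ≠ 0 ∧
      s * t = algebraMap k[X] W.toAffine.CoordinateRing N := by
  obtain ⟨p, q, rfl⟩ := CoordinateRing.exists_smul_basis_eq s
  have h := CoordinateRing.coe_norm_smul_basis (W' := W.toAffine) p q
  refine ⟨CoordinateRing.mk W.toAffine (C p + C q * (-(Y : k[X][Y]) - C (C W.a₁ * X + C W.a₃))),
    Algebra.norm k[X] (p • 1 + q • CoordinateRing.mk W.toAffine Y),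
    (Algebra.norm_ne_zero_iff (R := k[X])).mpr hs, ?_⟩
  refine Eq.trans ?_ h.symm
  rw [_root_.map_mul (CoordinateRing.mk W.toAffine), CoordinateRing.smul, CoordinateRing.smul,
    mul_one, map_add _ (C p) (C q * Y), _root_.map_mul _ (C q) Y]

/-- A ring homomorphism from the coordinate ring to a domain is injective if it is so on the
polynomials in `X`. -/
lemma CoordinateRing.injective_of_comp {L : Type*} [CommRing L] [IsDomain L]
    (f : W.toAffine.CoordinateRing →+* L)
    (hf : ∀ N : k[X], f (algebraMap k[X] W.toAffine.CoordinateRing N) = 0 → N = 0) :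
    Function.Injective f := by
  rw [injective_iff_map_eq_zero]
  intro s h
  by_contra hs
  obtain ⟨t, N, hN, hst⟩ := CoordinateRing.exists_mul_eq_algebraMap W hs
  refine hN (hf N ?_)
  rw [← hst, _root_.map_mul, h, zero_mul]

namespace FunctionField

/-- The function `x` on the curve. -/
noncomputable def x : W.toAffine.FunctionField := algebraMap k[X] _ X

/-- The function `y` on the curve. -/
noncomputable def y : W.toAffine.FunctionField :=
  algebraMap W.toAffine.CoordinateRing _ (CoordinateRing.mk W.toAffine Y)

lemma equation_x_y : (W⁄(W.toAffine.FunctionField)).toAffine.Equation (x W) (y W) := by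
  have h : CoordinateRing.mk W.toAffine W.toAffine.polynomial = 0 := AdjoinRoot.mk_self
  have h' := congrArg (algebraMap W.toAffine.CoordinateRing W.toAffine.FunctionField) h
  have hC (f : k[X]) : algebraMap W.toAffine.CoordinateRing W.toAffine.FunctionField
      (CoordinateRing.mk W.toAffine (C f)) = algebraMap k[X] _ f :=
    (IsScalarTower.algebraMap_apply k[X] W.toAffine.CoordinateRing W.toAffine.FunctionField f).symm
  have hCC (a : k) : algebraMap k[X] W.toAffine.FunctionField (C a) = algebraMap k _ a :=
    (IsScalarTower.algebraMap_apply k k[X] W.toAffine.FunctionField a).symm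
  rw [Affine.equation_baseChange_iff]
  simp only [Affine.polynomial, _root_.map_sub, _root_.map_add, _root_.map_mul, _root_.map_pow,
    hC, hCC, _root_.map_zero] at h'
  rw [x, y]
  linear_combination h'

variable {W} {L : Type*} [Field L] [Algebra k L]

/-- The homomorphism on the coordinate ring given by the values of `x` and `y`. -/
noncomputable def evalRing {u v : L} (h : (W⁄L).toAffine.Equation u v) :
    W.toAffine.CoordinateRing →+* L :=
  AdjoinRoot.lift (eval₂RingHom (algebraMap k L) u) v (by
    rw [Affine.equation_baseChange_iff] at h
    simp only [Affine.polynomial, eval₂_sub, eval₂_add, eval₂_mul, eval₂_pow, eval₂_C, eval₂_X,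
      coe_eval₂RingHom, _root_.map_add, _root_.map_mul, _root_.map_pow]
    linear_combination h)

lemma evalRing_algebraMap {u v : L} (h : (W⁄L).toAffine.Equation u v) (f : k[X]) :
    evalRing h (algebraMap k[X] _ f) = aeval u f :=
  AdjoinRoot.lift_of _

lemma evalRing_mk_Y {u v : L} (h : (W⁄L).toAffine.Equation u v) :
    evalRing h (CoordinateRing.mk W.toAffine Y) = v :=
  AdjoinRoot.lift_root _

lemma evalRing_injective {u v : L} (h : (W⁄L).toAffine.Equation u v) (hu : Transcendental k u) :
    Function.Injective (evalRing h) :=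
  CoordinateRing.injective_of_comp W _ fun N hN ↦ by
    rw [evalRing_algebraMap] at hN
    exact (transcendental_iff.mp hu) N hN

/-- The homomorphism on the function field given by the values of `x` and `y`, of which that of
`x` is transcendental. -/
noncomputable def evalHom {u v : L} (h : (W⁄L).toAffine.Equation u v)
    (hu : Transcendental k u) : W.toAffine.FunctionField →ₐ[k] L where
  __ := IsFractionRing.lift (A := W.toAffine.CoordinateRing) (K := W.toAffine.FunctionField)
    (g := evalRing h) (evalRing_injective h hu)
  commutes' r := by
    have h1 : algebraMap k W.toAffine.FunctionField r =
        algebraMap W.toAffine.CoordinateRing _ (algebraMap k[X] _ (C r)) := rfl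
    refine (congrArg _ h1).trans ((IsFractionRing.lift_algebraMap (evalRing_injective h hu) _).trans ?_)
    rw [evalRing_algebraMap, aeval_C]

lemma evalHom_algebraMap_coordinateRing {u v : L} (h : (W⁄L).toAffine.Equation u v)
    (hu : Transcendental k u) (s : W.toAffine.CoordinateRing) :
    evalHom h hu (algebraMap _ _ s) = evalRing h s :=
  IsFractionRing.lift_algebraMap (evalRing_injective h hu) _

lemma evalHom_algebraMap {u v : L} (h : (W⁄L).toAffine.Equation u v)
    (hu : Transcendental k u) (f : k[X]) :
    evalHom h hu (algebraMap k[X] _ f) = aeval u f := by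
  rw [IsScalarTower.algebraMap_apply k[X] W.toAffine.CoordinateRing W.toAffine.FunctionField,
    evalHom_algebraMap_coordinateRing, evalRing_algebraMap]

lemma evalHom_x {u v : L} (h : (W⁄L).toAffine.Equation u v) (hu : Transcendental k u) :
    evalHom h hu (x W) = u := by
  rw [x, evalHom_algebraMap, aeval_X]

lemma evalHom_y {u v : L} (h : (W⁄L).toAffine.Equation u v) (hu : Transcendental k u) :
    evalHom h hu (y W) = v := by
  rw [y, evalHom_algebraMap_coordinateRing, evalRing_mk_Y]

lemma algebraMap_injective : Function.Injective (algebraMap k[X] W.toAffine.FunctionField) :=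
  FaithfulSMul.algebraMap_injective _ _

lemma aeval_x (f : k[X]) : aeval (x W) f = algebraMap k[X] _ f := by
  rw [x, aeval_algebraMap_apply, aeval_X_left_apply]

lemma transcendental_x : Transcendental k (x W) := by
  rw [transcendental_iff]
  intro f hf
  rw [aeval_x] at hf
  exact (map_eq_zero_iff _ algebraMap_injective).mp hf

variable (W) in
/-- The automorphism of the function field induced by the negation of points. -/
noncomputable def negHom : W.toAffine.FunctionField →ₐ[k] W.toAffine.FunctionField :=
  evalHom (((W⁄(W.toAffine.FunctionField)).toAffine.equation_neg _ _).mpr (equation_x_y W))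
    transcendental_x

lemma negHom_algebraMap (f : k[X]) : negHom W (algebraMap k[X] _ f) = algebraMap k[X] _ f := by
  rw [negHom, evalHom_algebraMap, aeval_x]

lemma negHom_x : negHom W (x W) = x W := negHom_algebraMap X

lemma negHom_y :
    negHom W (y W) = (W⁄(W.toAffine.FunctionField)).toAffine.negY (x W) (y W) :=
  evalHom_y _ _

lemma algebraMap_smul_basis (p q : k[X]) :
    algebraMap W.toAffine.CoordinateRing W.toAffine.FunctionField
      (p • 1 + q • CoordinateRing.mk W.toAffine Y) =
      algebraMap k[X] _ p + algebraMap k[X] _ q * y W := by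
  rw [map_add, Algebra.smul_def, Algebra.smul_def, _root_.map_mul, map_one, mul_one, _root_.map_mul, ← y,
    ← IsScalarTower.algebraMap_apply, ← IsScalarTower.algebraMap_apply]

lemma y_ne_negY [W.IsElliptic] :
    y W ≠ (W⁄(W.toAffine.FunctionField)).toAffine.negY (x W) (y W) := by
  intro h
  have h1 : algebraMap W.toAffine.CoordinateRing W.toAffine.FunctionField
      ((C W.a₁ * X + C W.a₃ : k[X]) • 1 + (2 : k[X]) • CoordinateRing.mk W.toAffine Y) = 0 := by
    rw [algebraMap_smul_basis, map_add, _root_.map_mul, map_ofNat, ← x]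
    change y W = - y W - algebraMap k W.toAffine.FunctionField W.a₁ * x W -
      algebraMap k W.toAffine.FunctionField W.a₃ at h
    change algebraMap k W.toAffine.FunctionField W.a₁ * x W +
      algebraMap k W.toAffine.FunctionField W.a₃ + 2 * y W = 0
    linear_combination h
  rw [map_eq_zero_iff _ (IsFractionRing.injective _ _)] at h1
  obtain ⟨h2, h3⟩ := CoordinateRing.smul_basis_eq_zero h1
  have ha₁ : W.a₁ = 0 := by simpa using congrArg (coeff · 1) h2
  have ha₃ : W.a₃ = 0 := by simpa using congrArg (coeff · 0) h2
  have h4 : (2 : k) = 0 := by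
    rw [← map_ofNat C, C_eq_zero] at h3
    exact h3
  refine W.isUnit_Δ.ne_zero ?_
  rw [Δ, b₂, b₄, b₆, b₈, ha₁, ha₃]
  -- When a₁ = a₃ = 0 the discriminant is a multiple of 2, hence zero in characteristic 2.
  linear_combination (144 * W.a₂ * W.a₆ * W.a₄ + 8 * W.a₂ ^ 2 * W.a₄ ^ 2 -
    32 * W.a₂ ^ 3 * W.a₆ - 216 * W.a₆ ^ 2 - 32 * W.a₄ ^ 3) * h4

/-- Clearing the denominator by its norm gives N z = p + q y with polynomials N, p, q. Invariance
under negation forces q = 0, because y differs from its conjugate; so z is p / N in lowest terms. -/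
lemma exists_algebraMap_of_negHom_eq [W.IsElliptic] {z : W.toAffine.FunctionField}
    (hz : negHom W z = z) :
    ∃ f g : k[X], IsCoprime f g ∧ algebraMap k[X] _ f = algebraMap k[X] _ g * z := by
  classical
  obtain ⟨r, s, hs, rfl⟩ := IsFractionRing.div_surjective (A := W.toAffine.CoordinateRing) z
  obtain ⟨t, N, hN, hst⟩ :=
    CoordinateRing.exists_mul_eq_algebraMap W (nonZeroDivisors.ne_zero hs)
  obtain ⟨p, q, hpq⟩ := CoordinateRing.exists_smul_basis_eq (r * t)
  set z := algebraMap W.toAffine.CoordinateRing W.toAffine.FunctionField r / algebraMap _ _ s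
  have hs' : algebraMap W.toAffine.CoordinateRing W.toAffine.FunctionField s ≠ 0 := by
    rw [Ne, map_eq_zero_iff _ (IsFractionRing.injective _ _)]
    exact nonZeroDivisors.ne_zero hs
  have h1 : algebraMap k[X] _ N * z = algebraMap k[X] _ p + algebraMap k[X] _ q * y W := by
    rw [← algebraMap_smul_basis, hpq,
      IsScalarTower.algebraMap_apply k[X] W.toAffine.CoordinateRing W.toAffine.FunctionField N,
      ← hst, _root_.map_mul, _root_.map_mul]
    simp only [z]
    field_simp
  have h2 := congrArg (negHom W) h1
  rw [map_add, _root_.map_mul, _root_.map_mul, hz, negHom_algebraMap, negHom_algebraMap,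
    negHom_algebraMap, negHom_y, h1] at h2
  have h3 : algebraMap k[X] W.toAffine.FunctionField q = 0 :=
    (mul_eq_mul_left_iff.mp (add_left_cancel h2)).resolve_left y_ne_negY
  rw [h3, zero_mul, add_zero] at h1
  have hg : gcd p N ≠ 0 := gcd_ne_zero_of_right hN
  refine ⟨p / gcd p N, N / gcd p N, isCoprime_div_gcd_div_gcd hN, ?_⟩
  have hg' : algebraMap k[X] W.toAffine.FunctionField (gcd p N) ≠ 0 := by
    rwa [Ne, map_eq_zero_iff _ algebraMap_injective]
  refine mul_left_cancel₀ hg' ?_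
  rw [← _root_.map_mul, ← mul_assoc, ← _root_.map_mul, EuclideanDomain.mul_div_cancel' hg (gcd_dvd_left _ _),
    EuclideanDomain.mul_div_cancel' hg (gcd_dvd_right _ _), h1]

end FunctionField

end WeierstrassCurve.Affine

end FunctionField

open WeierstrassCurve.Affine (Point)

/-! ### Composition of rational functions multiplies degrees. -/

section Composition

variable {k : Type*} [Field k]

/-- The value at `u` of the form of degree `m` obtained from `f` by homogenization. -/
noncomputable def homogeneousEval {R : Type*} [CommRing R] [Algebra k R] (f : k[X]) (m : ℕ)
    (u : Fin 2 → R) : R :=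
  ∑ i ∈ Finset.range (m + 1), algebraMap k R (f.coeff i) * (u 0 ^ i * u 1 ^ (m - i))

lemma map_homogeneousEval {R S : Type*} [CommRing R] [CommRing S] [Algebra k R] [Algebra k S]
    (φ : R →ₐ[k] S) (f : k[X]) (m : ℕ) (u : Fin 2 → R) :
    φ (homogeneousEval f m u) = homogeneousEval f m (fun i ↦ φ (u i)) := by
  simp [homogeneousEval]

lemma homogeneousEval_mul {R : Type*} [CommRing R] [Algebra k R] {f : k[X]} {m : ℕ}
    (hf : f.natDegree ≤ m) (z w : R) :
    homogeneousEval f m ![w * z, w] = w ^ m * aeval z f := by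
  rw [aeval_eq_sum_range' (Nat.lt_succ_of_le hf), Finset.mul_sum, homogeneousEval]
  refine Finset.sum_congr rfl fun i hi ↦ ?_
  have : m = (m - i) + i := by grind
  rw [Algebra.smul_def]
  simp only [Matrix.cons_val_zero, Matrix.cons_val_one]
  conv_rhs => rw [this, pow_add]
  ring

lemma homogeneousEval_zero {R : Type*} [CommRing R] [Algebra k R] (f : k[X]) (m : ℕ) (z : R) :
    homogeneousEval f m ![z, 0] = algebraMap k R (f.coeff m) * z ^ m := by
  rw [homogeneousEval, Finset.sum_range_succ, Finset.sum_eq_zero]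
  · simp
  · intro i hi
    have : m - i ≠ 0 := by grind
    simp [this]

lemma HasNoCommonZero.homogeneousEval_ne_zero {w : Fin 2 → k[X]} (hw : HasNoCommonZero w)
    {c : Fin 2 → k} (hc : c ≠ 0) : (fun i ↦ homogeneousEval (w i) (maxDegree w) c) ≠ 0 := by
  by_cases h1 : c 1 = 0
  · have h0 : c 0 ≠ 0 := fun h0 ↦ hc (by ext i; fin_cases i <;> simp [h0, h1])
    have hc' : c = ![c 0, 0] := by ext i; fin_cases i <;> simp [h1]
    obtain ⟨i, hi⟩ := Function.ne_iff.mp (coeff_maxDegree_ne_zero hw.ne_zero)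
    refine Function.ne_iff.mpr ⟨i, ?_⟩
    rw [hc', homogeneousEval_zero]
    exact mul_ne_zero hi (pow_ne_zero _ h0)
  · have hc' : c = ![c 1 * (c 0 / c 1), c 1] := by
      ext i; fin_cases i
      · simp; field_simp
      · simp
    obtain ⟨i, hi⟩ := hw (c 0 / c 1)
    refine Function.ne_iff.mpr ⟨i, ?_⟩
    rw [hc', homogeneousEval_mul (natDegree_le_maxDegree w i), coe_aeval_eq_eval]
    exact mul_ne_zero (pow_ne_zero _ h1) hi

lemma HasNoCommonZero.homogeneousEval {w u : Fin 2 → k[X]} (hw : HasNoCommonZero w)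
    (hu : HasNoCommonZero u) :
    HasNoCommonZero fun i ↦ homogeneousEval (w i) (maxDegree w) u := by
  intro a
  obtain ⟨i, hi⟩ := Function.ne_iff.mp
    (hw.homogeneousEval_ne_zero (c := fun i ↦ (u i).eval a) (Function.ne_iff.mpr (hu a)))
  refine ⟨i, ?_⟩
  rw [← coe_aeval_eq_eval, map_homogeneousEval]
  exact hi

lemma hasTop_homogeneousEval (f : k[X]) (m : ℕ) {u : Fin 2 → k[X]} {D : ℕ} {a : Fin 2 → k}
    (hu : ∀ i, (u i).HasTop D (a i)) :
    (homogeneousEval f m u).HasTop (m * D) (homogeneousEval f m a) := by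
  refine HasTop.sum _ _ _ fun i hi ↦ HasTop.C_mul _ ?_
  have : m * D = i * D + (m - i) * D := by rw [← add_mul]; congr 1; grind
  rw [this]
  exact ((hu 0).pow i).mul ((hu 1).pow _)

lemma maxDegree_homogeneousEval {w u : Fin 2 → k[X]} (hw : HasNoCommonZero w) (hu : u ≠ 0) :
    maxDegree (fun i ↦ homogeneousEval (w i) (maxDegree w) u) = maxDegree w * maxDegree u :=
  maxDegree_eq (fun i ↦ hasTop_homogeneousEval (w i) _ (hasTop_maxDegree u))
    (hw.homogeneousEval_ne_zero (coeff_maxDegree_ne_zero hu))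

lemma maxDegree_pow {n : ℕ} (u : Fin n → k[X]) (q : ℕ) :
    maxDegree (fun i ↦ u i ^ q) = q * maxDegree u := by
  simp only [maxDegree, natDegree_pow]
  exact (Finset.apply_sup_eq_sup_comp (q * ·) (fun a b ↦ Nat.mul_max_mul_left .. |>.symm) rfl).symm

end Composition

/-! ### Odd points over the function field and their abscissas. -/

section OddPoints

variable {F : Type*} [Field F] (W : WeierstrassCurve F) [W.IsElliptic]
  (k : Type*) [Field k] [Algebra F k]

instance : (W⁄k).IsElliptic := inferInstanceAs (W.map _).IsElliptic

omit [W.IsElliptic] in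
variable {W} in
lemma WeierstrassCurve.Affine.Point.xRep_map {K L : Type*} [Field K] [Field L] [Algebra F K]
    [Algebra F L] [DecidableEq K] [DecidableEq L] (f : K →ₐ[F] L) (P : (W⁄K).toAffine.Point)
    (i : Fin 2) : (Point.map f P).xRep i = f (P.xRep i) := by
  rcases P with _ | ⟨x, y, h⟩
  · change (![1, 0] : Fin 2 → L) i = f ((![1, 0] : Fin 2 → K) i)
    fin_cases i <;> simp
  · change (![f x, 1] : Fin 2 → L) i = f ((![x, 1] : Fin 2 → K) i)
    fin_cases i <;> simp

/-- The function field of the base change of a curve. -/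
def FunField : Type _ := (W⁄k).toAffine.FunctionField

namespace FunField

noncomputable instance : Field (FunField W k) :=
  inferInstanceAs (Field (W⁄k).toAffine.FunctionField)

noncomputable instance : DecidableEq (FunField W k) := Classical.decEq _

noncomputable instance : Algebra F (FunField W k) :=
  inferInstanceAs (Algebra F (W⁄k).toAffine.FunctionField)

noncomputable instance : Algebra k (FunField W k) :=
  inferInstanceAs (Algebra k (W⁄k).toAffine.FunctionField)

noncomputable instance : Algebra k[X] (FunField W k) :=
  inferInstanceAs (Algebra k[X] (W⁄k).toAffine.FunctionField)

instance : IsScalarTower F k (FunField W k) :=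
  inferInstanceAs (IsScalarTower F k (W⁄k).toAffine.FunctionField)

instance : IsScalarTower F k[X] (FunField W k) :=
  inferInstanceAs (IsScalarTower F k[X] (W⁄k).toAffine.FunctionField)

instance : IsScalarTower k k[X] (FunField W k) :=
  inferInstanceAs (IsScalarTower k k[X] (W⁄k).toAffine.FunctionField)

instance : FaithfulSMul k[X] (FunField W k) :=
  inferInstanceAs (FaithfulSMul k[X] (W⁄k).toAffine.FunctionField)

/-- The function `x`. -/
noncomputable def x : FunField W k := Affine.FunctionField.x (W⁄k)

omit [W.IsElliptic] in
lemma algebraMap_X : algebraMap k[X] (FunField W k) X = x W k := rfl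

/-- The function `y`. -/
noncomputable def y : FunField W k := Affine.FunctionField.y (W⁄k)

omit [W.IsElliptic] in
lemma baseChange_baseChange (L : Type*) [Field L] [Algebra F L] [Algebra k L]
    [IsScalarTower F k L] : (W⁄k)⁄L = W⁄L := by
  rw [WeierstrassCurve.baseChange, WeierstrassCurve.baseChange, WeierstrassCurve.map_map,
    ← IsScalarTower.algebraMap_eq]
  rfl

omit [W.IsElliptic] in
lemma equation_x_y : (W⁄(FunField W k)).toAffine.Equation (x W k) (y W k) := by
  rw [← baseChange_baseChange W k]
  exact Affine.FunctionField.equation_x_y (W⁄k)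

omit [W.IsElliptic] in
variable {W k} in
lemma equation_baseChange {L : Type*} [Field L] [Algebra F L] [Algebra k L] [IsScalarTower F k L]
    {u v : L} (h : (W⁄L).toAffine.Equation u v) : ((W⁄k)⁄L).toAffine.Equation u v := by
  rwa [baseChange_baseChange W k]

variable {W k} in
/-- The homomorphism on the function field given by the values of `x` and `y`, of which that of
`x` is transcendental. -/
noncomputable def evalHom {L : Type*} [Field L] [Algebra F L] [Algebra k L] [IsScalarTower F k L]
    {u v : L} (h : (W⁄L).toAffine.Equation u v) (hu : Transcendental k u) :
    FunField W k →ₐ[F] L :=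
  (Affine.FunctionField.evalHom (W := W⁄k) (equation_baseChange h) hu).restrictScalars F

section

variable {W k} {L : Type*} [Field L] [Algebra F L] [Algebra k L] [IsScalarTower F k L]
    {u v : L} (h : (W⁄L).toAffine.Equation u v) (hu : Transcendental k u)

omit [W.IsElliptic] in
lemma evalHom_algebraMap (f : k[X]) : evalHom h hu (algebraMap k[X] _ f) = aeval u f :=
  Affine.FunctionField.evalHom_algebraMap (equation_baseChange h) hu f

omit [W.IsElliptic] in
lemma evalHom_x : evalHom h hu (x W k) = u := Affine.FunctionField.evalHom_x (equation_baseChange h) hu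

omit [W.IsElliptic] in
lemma evalHom_y : evalHom h hu (y W k) = v := Affine.FunctionField.evalHom_y (equation_baseChange h) hu

end

/-- The automorphism of the function field induced by the negation of points. -/
noncomputable def negHom : FunField W k →ₐ[F] FunField W k :=
  (Affine.FunctionField.negHom (W⁄k)).restrictScalars F

omit [W.IsElliptic] in
lemma negHom_apply (z : FunField W k) :
    negHom W k z = Affine.FunctionField.negHom (W⁄k) z := rfl

omit [W.IsElliptic] in
lemma negHom_x : negHom W k (x W k) = x W k :=
  (negHom_apply W k _).trans (Affine.FunctionField.negHom_x (W := W⁄k))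

omit [W.IsElliptic] in
lemma negHom_y :
    negHom W k (y W k) = (W⁄(FunField W k)).toAffine.negY (x W k) (y W k) := by
  rw [← baseChange_baseChange W k]
  exact (negHom_apply W k _).trans (Affine.FunctionField.negHom_y (W := W⁄k))

variable {W k} in
lemma exists_algebraMap_of_negHom_eq {z : FunField W k} (hz : negHom W k z = z) :
    ∃ f g : k[X], IsCoprime f g ∧ algebraMap k[X] _ f = algebraMap k[X] _ g * z :=
  Affine.FunctionField.exists_algebraMap_of_negHom_eq (W := W⁄k) hz

end FunField

section OfRing

variable (W : WeierstrassCurve F) (k : Type*) [Field k] [Algebra F k]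

/-- The inclusion of the coordinate ring into the function field. -/
noncomputable def FunField.ofRing : (W⁄k).toAffine.CoordinateRing →+* FunField W k :=
  algebraMap (W⁄k).toAffine.CoordinateRing (W⁄k).toAffine.FunctionField

lemma FunField.ofRing_injective : Function.Injective (FunField.ofRing W k) :=
  IsFractionRing.injective (W⁄k).toAffine.CoordinateRing (W⁄k).toAffine.FunctionField

lemma FunField.ofRing_algebraMap (f : k[X]) :
    FunField.ofRing W k (algebraMap k[X] _ f) = algebraMap k[X] _ f :=
  (IsScalarTower.algebraMap_apply k[X] (W⁄k).toAffine.CoordinateRing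
    (W⁄k).toAffine.FunctionField f).symm

lemma FunField.ofRing_mk_Y : FunField.ofRing W k (Affine.CoordinateRing.mk _ X) = FunField.y W k :=
  rfl

end OfRing

/-- The generic point of the curve. -/
noncomputable def generalPoint : (W⁄(FunField W k)).toAffine.Point :=
  have : (W⁄(FunField W k)).IsElliptic := inferInstanceAs (W.map _).IsElliptic
  Point.mk (FunField.equation_x_y W k)

/-- The subgroup of the points over the function field that the negation of the curve maps
to their negatives. -/
noncomputable def oddPoints : AddSubgroup (W⁄(FunField W k)).toAffine.Point :=
  (Point.map (FunField.negHom W k) + AddMonoidHom.id _).ker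

variable {W k}

omit [W.IsElliptic] in
lemma mem_oddPoints {P : (W⁄(FunField W k)).toAffine.Point} :
    P ∈ oddPoints W k ↔ Point.map (FunField.negHom W k) P = -P := by
  rw [oddPoints, AddMonoidHom.mem_ker, AddMonoidHom.add_apply, AddMonoidHom.id_apply,
    add_eq_zero_iff_eq_neg]

lemma generalPoint_mem_oddPoints : generalPoint W k ∈ oddPoints W k := by
  rw [mem_oddPoints, generalPoint, Point.mk, Point.map_some, Point.neg_some, Point.some.injEq]
  exact ⟨FunField.negHom_x W k, FunField.negHom_y W k⟩

lemma IsCoprime.hasNoCommonZero {f g : k[X]} (h : IsCoprime f g) : HasNoCommonZero ![f, g] := by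
  obtain ⟨a, b, hab⟩ := h
  intro x
  by_contra! h0
  have h1 : f.eval x = 0 := h0 0
  have h2 : g.eval x = 0 := h0 1
  simpa [h1, h2] using congrArg (eval x) hab

/-- Negating a point does not change its abscissa, so that of an odd point is invariant under the
negation automorphism and lies in k(x). -/
lemma exists_isXRep {P : (W⁄(FunField W k)).toAffine.Point} (hP : P ∈ oddPoints W k) :
    ∃ u : Fin 2 → k[X], IsXRep P u := by
  rcases P with _ | ⟨x, y, h⟩
  · exact ⟨![1, 0], isCoprime_one_left.hasNoCommonZero, by simp [Point.xRep]⟩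
  · rw [mem_oddPoints, Point.map_some, Point.neg_some, Point.some.injEq] at hP
    obtain ⟨f, g, hfg, h⟩ := FunField.exists_algebraMap_of_negHom_eq hP.1
    exact ⟨![f, g], hfg.hasNoCommonZero, by simp [Point.xRep, h]⟩

lemma isXRep_generalPoint : IsXRep (generalPoint W k) (![X, 1] : Fin 2 → k[X]) := by
  refine ⟨fun a ↦ ⟨1, by simp⟩, ?_⟩
  simp [generalPoint, Point.mk, FunField.algebraMap_X]

end OddPoints

/-! ### Frobenius on odd points and multiplicativity of the degree. -/

section Frobenius

variable {F : Type*} [Field F] (W : WeierstrassCurve F) [W.IsElliptic]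
  (k : Type*) [Field k] [Algebra F k]

/-- The degree of the `x`-coordinate on odd points. -/
noncomputable def oddDegree (P : oddPoints W k) : ℤ := xDegree k P.1

/-- The generic point as an odd point. -/
noncomputable def oddGeneralPoint : oddPoints W k := ⟨_, generalPoint_mem_oddPoints⟩

omit [W.IsElliptic] in
lemma oddDegree_nonneg (P : oddPoints W k) : 0 ≤ oddDegree W k P := Int.natCast_nonneg _

lemma parallelogramLaw_oddDegree [IsAlgClosed k] : ParallelogramLaw (oddDegree W k) := by
  intro P Q
  obtain ⟨u₁, h₁⟩ := exists_isXRep P.2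
  obtain ⟨u₂, h₂⟩ := exists_isXRep Q.2
  obtain ⟨u₃, h₃⟩ := exists_isXRep (P + Q).2
  obtain ⟨u₄, h₄⟩ := exists_isXRep (P - Q).2
  have h := IsXRep.maxDegree_add h₁ h₂ h₃ h₄
  rw [oddDegree, oddDegree, oddDegree, oddDegree, h₁.xDegree_eq, h₂.xDegree_eq, h₃.xDegree_eq,
    h₄.xDegree_eq]
  exact_mod_cast h

lemma oddDegree_oddGeneralPoint [IsAlgClosed k] : oddDegree W k (oddGeneralPoint W k) = 1 := by
  have h := isXRep_generalPoint (W := W) (k := k)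
  rw [oddDegree, oddGeneralPoint, h.xDegree_eq]
  simp [maxDegree, Fin.univ_succ]

variable [Fintype F]

/-- The Frobenius endomorphism of the odd points over the function field. -/
noncomputable def frobeniusHom : oddPoints W k →+ oddPoints W k :=
  ((Point.map (FiniteField.frobeniusAlgHom F (FunField W k))).comp
    (oddPoints W k).subtype).codRestrict _ fun P ↦ by
      have hP := mem_oddPoints.mp P.2
      rw [mem_oddPoints]
      simp only [AddMonoidHom.comp_apply, AddSubgroup.subtype_apply]
      rw [← _root_.map_neg, ← hP, Point.map_map, Point.map_map]
      congr 2
      ext x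
      change FunField.negHom W k (x ^ Fintype.card F) = (FunField.negHom W k x) ^ Fintype.card F
      rw [_root_.map_pow]

variable {W k}

lemma oddDegree_frobeniusHom [IsAlgClosed k] (P : oddPoints W k) :
    oddDegree W k (frobeniusHom W k P) = Fintype.card F * oddDegree W k P := by
  obtain ⟨u, h⟩ := exists_isXRep P.2
  have h' : IsXRep (frobeniusHom W k P).1 fun i ↦ u i ^ Fintype.card F := by
    refine ⟨fun a ↦ ?_, ?_⟩
    · obtain ⟨i, hi⟩ := h.1 a
      exact ⟨i, by rw [eval_pow]; exact pow_ne_zero _ hi⟩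
    · have hx (i) : (frobeniusHom W k P).1.xRep i = P.1.xRep i ^ Fintype.card F :=
        Point.xRep_map (FiniteField.frobeniusAlgHom F (FunField W k)) P.1 i
      rw [hx, hx, _root_.map_pow, _root_.map_pow, ← mul_pow, ← mul_pow, h.2]
  rw [oddDegree, oddDegree, h.xDegree_eq, h'.xDegree_eq, maxDegree_pow]
  push_cast; rfl

omit [W.IsElliptic] [Fintype F] in
-- An element algebraic over the algebraically closed field k is a constant, and a constant has
-- degree zero.
lemma transcendental_of_isXRep [IsAlgClosed k] {x y : FunField W k} {h} {u : Fin 2 → k[X]}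
    (hu : IsXRep (W := W) (Point.some x y h) u) (hdeg : maxDegree u ≠ 0) : Transcendental k x := by
  intro hx
  have hdeg1 := IsAlgClosed.degree_eq_one_of_irreducible k (minpoly.irreducible hx.isIntegral)
  obtain ⟨c, rfl⟩ := minpoly.mem_range_of_degree_eq_one k x hdeg1
  have h2 : algebraMap k[X] (FunField W k) (u 0) * 1 =
    algebraMap k[X] (FunField W k) (u 1) * algebraMap k (FunField W k) c := hu.2
  rw [IsScalarTower.algebraMap_apply k k[X], ← _root_.map_mul, mul_one] at h2
  have h3 : u 0 = u 1 * C c := FaithfulSMul.algebraMap_injective k[X] (FunField W k) h2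
  have h4 : (u 1).degree = 0 := by
    by_contra hd
    obtain ⟨a, ha⟩ := IsAlgClosed.exists_root _ hd
    obtain ⟨i, hi⟩ := hu.1 a
    fin_cases i
    · simp [h3, ha.eq_zero] at hi
    · exact hi ha
  rw [eq_C_of_degree_eq_zero h4, ← C_mul] at h3
  refine hdeg (maxDegree_eq (a := fun i ↦ (u i).coeff 0) (fun i ↦ ⟨?_, rfl⟩) ?_)
  · fin_cases i
    · change (u 0).natDegree ≤ 0
      rw [h3, natDegree_C]
    · exact (natDegree_eq_of_degree_eq_some h4).le
  · refine Function.ne_iff.mpr ⟨1, fun h5 ↦ ?_⟩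
    rw [eq_C_of_degree_eq_zero h4] at h4
    have h6 : (u 1).coeff 0 = 0 := h5
    simp [h6] at h4

omit [W.IsElliptic] [Fintype F] in
lemma IsXRep.map_evalHom [IsAlgClosed k] {x y : FunField W k}
    {h : (W⁄(FunField W k)).toAffine.Nonsingular x y} (hx : Transcendental k x)
    {P : (W⁄(FunField W k)).toAffine.Point} {u w : Fin 2 → k[X]} (hP : IsXRep P w)
    (hu : IsXRep (W := W) (Point.some x y h) u) :
    IsXRep (Point.map (FunField.evalHom h.1 hx) P)
      (fun i ↦ homogeneousEval (w i) (maxDegree w) u) := by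
  refine ⟨hP.1.homogeneousEval hu.1, ?_⟩
  have h2 : algebraMap k[X] (FunField W k) (u 0) = algebraMap k[X] (FunField W k) (u 1) * x :=
    (mul_one _).symm.trans hu.2
  have hu' : (fun i ↦ algebraMap k[X] (FunField W k) (u i)) =
      ![algebraMap k[X] (FunField W k) (u 1) * x, algebraMap k[X] (FunField W k) (u 1)] := by
    ext i; fin_cases i
    · exact h2
    · rfl
  have key (i) : algebraMap k[X] (FunField W k) (homogeneousEval (w i) (maxDegree w) u) =
      algebraMap k[X] (FunField W k) (u 1) ^ maxDegree w * aeval x (w i) := by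
    rw [← homogeneousEval_mul (natDegree_le_maxDegree w i), ← hu']
    exact map_homogeneousEval (IsScalarTower.toAlgHom k k[X] (FunField W k)) _ _ _
  rw [key, key, Point.xRep_map, Point.xRep_map, ← FunField.evalHom_algebraMap h.1 hx,
    ← FunField.evalHom_algebraMap h.1 hx, mul_assoc, mul_assoc, ← _root_.map_mul, ← _root_.map_mul,
    hP.2]

/-- With α = φe + e, the substitution e ↦ α commutes with φ and sends φe - e to φα - α = φ²e - e. On
abscissas it is composition of rational functions. -/
lemma oddDegree_frobenius_sq_sub [IsAlgClosed k] :
    oddDegree W k (frobeniusHom W k (frobeniusHom W k (oddGeneralPoint W k)) -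
      oddGeneralPoint W k) =
    oddDegree W k (frobeniusHom W k (oddGeneralPoint W k) - oddGeneralPoint W k) *
      oddDegree W k (frobeniusHom W k (oddGeneralPoint W k) + oddGeneralPoint W k) := by
  set φ := frobeniusHom W k
  set e := oddGeneralPoint W k
  set α := φ e + e with hα
  have hd := parallelogramLaw_oddDegree (W := W) (k := k)
  have hsub : φ (φ e) - e = φ α - α := by rw [hα, _root_.map_add]; abel
  rw [hsub]
  -- In degree zero α need not have a transcendental abscissa and cannot be substituted; but then α
  -- and φα lie in the radical and both sides vanish.
  by_cases h0 : oddDegree W k α = 0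
  · have h1 : oddDegree W k (φ α) = 0 := by rw [oddDegree_frobeniusHom, h0, mul_zero]
    rw [hd.map_sub, hd.polarHom_eq_zero (oddDegree_nonneg W k) h1, h0, h1]
    ring
  obtain ⟨u, hu⟩ := exists_isXRep α.2
  obtain ⟨w, hw⟩ := exists_isXRep (φ e - e).2
  rcases hαP : α.1 with _ | ⟨x, y, h⟩
  · refine absurd ?_ h0
    have : α = 0 := Subtype.ext hαP
    rw [this, hd.map_zero]
  · rw [hαP] at hu
    have hdeg : oddDegree W k α = maxDegree u := by rw [oddDegree, hαP, hu.xDegree_eq]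
    have hx := transcendental_of_isXRep hu (by rw [hdeg] at h0; exact_mod_cast h0)
    have hmap := hw.map_evalHom hx hu
    have he : Point.map (FunField.evalHom h.1 hx) e.1 = α.1 := by
      rw [hαP]
      change Point.some _ _ _ = _
      rw [Point.some.injEq]
      exact ⟨FunField.evalHom_x _ _, FunField.evalHom_y _ _⟩
    have hcomm : Point.map (FunField.evalHom h.1 hx) (φ e).1 = (φ α).1 := by
      change Point.map _ (Point.map _ e.1) = Point.map _ α.1
      rw [← he, Point.map_map, Point.map_map]
      congr 2
      ext z
      exact _root_.map_pow (FunField.evalHom h.1 hx) z _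
    have hval : Point.map (FunField.evalHom h.1 hx) (φ e - e).1 = (φ α - α).1 := by
      rw [AddSubgroup.coe_sub, _root_.map_sub, hcomm, he]; rfl
    rw [hval] at hmap
    rw [hdeg, oddDegree, oddDegree, hmap.xDegree_eq, hw.xDegree_eq,
      maxDegree_homogeneousEval hw.1 hu.1.ne_zero]
    push_cast; rfl

end Frobenius

/-! ### Roots of X^Q - X and their multiplicities. -/

section SeparableDegree

variable {k : Type*} [Field k]

lemma symSq_eq_zero {u v : Fin 2 → k} (hu : u ≠ 0) (hv : v ≠ 0) (h1 : symSq u v 1 = 0)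
    (h2 : symSq u v 2 = 0) : u 1 = 0 ∧ v 1 = 0 := by
  have h1' : u 0 * v 1 + u 1 * v 0 = 0 := h1
  have h2' : u 1 * v 1 = 0 := h2
  have hu' : u 0 ≠ 0 ∨ u 1 ≠ 0 := by
    by_contra! h; exact hu (by ext i; fin_cases i <;> simp [h])
  have hv' : v 0 ≠ 0 ∨ v 1 ≠ 0 := by
    by_contra! h; exact hv (by ext i; fin_cases i <;> simp [h])
  grind

variable (k) in
open scoped Classical in
/-- The elements fixed by raising to the power `Q`. -/
noncomputable def fixedElements (Q : ℕ) : Finset k := (X ^ Q - X : k[X]).roots.toFinset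

lemma mem_fixedElements {Q : ℕ} (hQ : 1 < Q) {a : k} : a ∈ fixedElements k Q ↔ a ^ Q = a := by
  classical
  rw [fixedElements, Multiset.mem_toFinset, mem_roots (FiniteField.X_pow_card_sub_X_ne_zero k hQ)]
  simp [sub_eq_zero]

lemma rootMultiplicity_X_pow_sub_X_sq {p Q : ℕ} [CharP k p] (hp : p ∣ Q) (hQ : 1 < Q) {a : k}
    (ha : a ^ Q = a) : rootMultiplicity a ((X ^ Q - X) ^ 2 : k[X]) = 2 := by
  classical
  have hne := FiniteField.X_pow_card_sub_X_ne_zero k hQ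
  rw [← count_roots, roots_pow, Multiset.count_nsmul, Multiset.count_eq_one_of_mem]
  · exact nodup_roots (galois_poly_separable p Q hp)
  · rw [mem_roots hne]
    simp [ha]

end SeparableDegree

/-! ### The poles of the abscissa of φⁿe - e. -/

section FrobeniusSub

variable {F : Type*} [Field F] [Fintype F] {W : WeierstrassCurve F} [W.IsElliptic]
  {k : Type*} [Field k] [Algebra F k]

lemma frobeniusHom_iterate_eq (n : ℕ) : ∃ h, ((frobeniusHom W k)^[n] (oddGeneralPoint W k)).1 =
    Point.some (FunField.x W k ^ Fintype.card F ^ n) (FunField.y W k ^ Fintype.card F ^ n) h := by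
  induction n with
  | zero =>
    simp only [pow_zero, pow_one]
    exact ⟨(Affine.equation_iff_nonsingular (W := W⁄(FunField W k))).mp
      (FunField.equation_x_y W k), rfl⟩
  | succ n ih =>
    obtain ⟨h, hn⟩ := ih
    have h' := (Affine.baseChange_nonsingular (W := W)
      (FiniteField.frobeniusAlgHom F (FunField W k)).injective _ _).mpr h
    have hs : ((frobeniusHom W k)^[n + 1] (oddGeneralPoint W k)).1 =
        Point.map (FiniteField.frobeniusAlgHom F (FunField W k))
        ((frobeniusHom W k)^[n] (oddGeneralPoint W k)).1 := by
      rw [Function.iterate_succ_apply']; rfl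
    rw [hn, Point.map_some] at hs
    rw [pow_succ, pow_mul, pow_mul]
    exact ⟨h', hs⟩

omit [Fintype F] [W.IsElliptic] in
lemma x_pow_ne_x {Q : ℕ} (hQ : 1 < Q) : FunField.x W k ^ Q ≠ FunField.x W k := by
  rw [← FunField.algebraMap_X, ← _root_.map_pow]
  intro h
  have := FaithfulSMul.algebraMap_injective k[X] (FunField W k) h
  exact FiniteField.X_pow_card_sub_X_ne_zero k hQ (sub_eq_zero.mpr this)

lemma isXRep_frobeniusHom_iterate (n : ℕ) :
    IsXRep ((frobeniusHom W k)^[n] (oddGeneralPoint W k)).1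
      (![X ^ Fintype.card F ^ n, 1] : Fin 2 → k[X]) := by
  obtain ⟨h, hn⟩ := frobeniusHom_iterate_eq (W := W) (k := k) n
  rw [hn]
  refine ⟨fun a ↦ ⟨1, by simp⟩, ?_⟩
  simp [FunField.algebraMap_X]


lemma mul_mul_eq_of_eq_mul_slope {K : Type*} [Field K] {a₁ a₂ x x' y₁ y₂ f g c v : K}
    (hne : x' - x ≠ 0)
    (hf : f = g * (((y₁ - y₂) / (x' - x)) ^ 2 + a₁ * ((y₁ - y₂) / (x' - x)) - a₂ - x' - x))
    (hv : (x' - x) ^ 2 = c * (g * v)) :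
    c * (f * v) = (y₁ - y₂) ^ 2 + a₁ * (x' - x) * (y₁ - y₂) - (a₂ + x' + x) * (x' - x) ^ 2 := by
  calc c * (f * v) = (x' - x) ^ 2 *
        (((y₁ - y₂) / (x' - x)) ^ 2 + a₁ * ((y₁ - y₂) / (x' - x)) - a₂ - x' - x) := by
        rw [hv, hf]; ring
    _ = _ := by field_simp; ring

omit [Fintype F] [W.IsElliptic] in
/-- The abscissa of a sum of points with abscissas `x ^ Q` and `x`, evaluated at a point. -/
lemma eval_mul_eq_of_isXRep_add {Q : ℕ} (hQ : 1 < Q) {s₁ s₂ : (W⁄k).toAffine.CoordinateRing}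
    {y₁ y₂ : FunField W k}
    {h₁ : (W⁄(FunField W k)).toAffine.Nonsingular (FunField.x W k ^ Q) y₁}
    {h₂ : (W⁄(FunField W k)).toAffine.Nonsingular (FunField.x W k) y₂}
    (hs₁ : FunField.ofRing W k s₁ = y₁) (hs₂ : FunField.ofRing W k s₂ = y₂)
    {u : Fin 2 → k[X]} (hu : IsXRep (W := W) (Point.some _ _ h₁ + Point.some _ _ h₂) u)
    {c : k} {v : k[X]} (hv : (X ^ Q - X) ^ 2 = C c * (u 1 * v))
    {a b : k} (hab : ((W⁄k)⁄k).toAffine.Equation a b) (ha : a ^ Q = a) :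
    c * ((u 0).eval a * v.eval a) = (Affine.FunctionField.evalRing hab s₁ -
      Affine.FunctionField.evalRing hab s₂) ^ 2 := by
  have hne : FunField.x W k ^ Q ≠ FunField.x W k := x_pow_ne_x hQ
  have hne' := sub_ne_zero.mpr hne
  rw [Affine.Point.add_of_X_ne hne] at hu
  have hslope := Affine.slope_of_X_ne (W := W⁄(FunField W k)) (y₁ := y₁) (y₂ := y₂) hne
  have hu2 : algebraMap k[X] (FunField W k) (u 0) * 1 =
    algebraMap k[X] (FunField W k) (u 1) * (W⁄(FunField W k)).toAffine.addX (FunField.x W k ^ Q)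
      (FunField.x W k) ((W⁄(FunField W k)).toAffine.slope (FunField.x W k ^ Q)
      (FunField.x W k) y₁ y₂) := hu.2
  rw [hslope] at hu2
  change _ = _ * (_ ^ 2 + algebraMap F (FunField W k) W.a₁ * _ -
    algebraMap F (FunField W k) W.a₂ - _ - _) at hu2
  have hv2 := congrArg (algebraMap k[X] (FunField W k)) hv
  have hF (r : F) : algebraMap F (FunField W k) r =
      algebraMap k[X] (FunField W k) (C (algebraMap F k r)) :=
    IsScalarTower.algebraMap_apply F k[X] (FunField W k) r
  have hR : algebraMap k[X] _ (C c * (u 0 * v)) =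
      (s₁ - s₂) ^ 2 + algebraMap k[X] _ (C (algebraMap F k W.a₁) * (X ^ Q - X)) * (s₁ - s₂) -
        algebraMap k[X] _ ((C (algebraMap F k W.a₂) + X ^ Q + X) * (X ^ Q - X) ^ 2) := by
    apply FunField.ofRing_injective W k
    rw [hF, hF, mul_one] at hu2
    simp only [_root_.map_mul, _root_.map_pow, _root_.map_sub, _root_.map_add,
      FunField.algebraMap_X, FunField.ofRing_algebraMap, hs₁, hs₂] at hv2 ⊢
    exact mul_mul_eq_of_eq_mul_slope hne' hu2 hv2
  have hk := congrArg (Affine.FunctionField.evalRing hab) hR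
  rw [_root_.map_sub, _root_.map_add, _root_.map_mul _ (algebraMap _ _ _) (s₁ - s₂),
    _root_.map_pow _ (s₁ - s₂), _root_.map_sub _ s₁, Affine.FunctionField.evalRing_algebraMap,
    Affine.FunctionField.evalRing_algebraMap, Affine.FunctionField.evalRing_algebraMap,
    coe_aeval_eq_eval] at hk
  simpa [ha] using hk

variable [IsAlgClosed k]

open scoped Classical in
/-- The points of the curve with coordinates fixed by raising to the power `Q`. -/
noncomputable def fixedOrdinates (W : WeierstrassCurve k) (Q : ℕ) (a : k) : Finset k :=
  (fixedElements k Q).filter fun b ↦ W.toAffine.Equation a b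

omit [W.IsElliptic] [IsAlgClosed k] in
lemma exists_algHom_eq_pow (n : ℕ) : ∃ ψ : k →ₐ[F] k, ∀ z, ψ z = z ^ Fintype.card F ^ n := by
  induction n with
  | zero => exact ⟨AlgHom.id F k, fun z ↦ by simp⟩
  | succ n ih =>
    obtain ⟨ψ, hψ⟩ := ih
    refine ⟨(FiniteField.frobeniusAlgHom F k).comp ψ, fun z ↦ ?_⟩
    rw [AlgHom.comp_apply, hψ, pow_succ, pow_mul]
    rfl

omit [W.IsElliptic] [IsAlgClosed k] in
lemma pow_eq_or_of_equation {n : ℕ} {a b : k} (hab : (W⁄k).toAffine.Equation a b)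
    (ha : a ^ Fintype.card F ^ n = a) :
    b ^ Fintype.card F ^ n = b ∨ b ^ Fintype.card F ^ n = (W⁄k).toAffine.negY a b := by
  obtain ⟨ψ, hψ⟩ := exists_algHom_eq_pow (F := F) (k := k) n
  have h := (Affine.baseChange_equation (W := W) ψ.injective a b).mpr hab
  rw [hψ, hψ, ha] at h
  exact Affine.Y_eq_of_X_eq h hab rfl

omit [W.IsElliptic] [IsAlgClosed k] in
lemma negY_pow {n : ℕ} {a : k} (b : k) (ha : a ^ Fintype.card F ^ n = a) :
    (W⁄k).toAffine.negY a b ^ Fintype.card F ^ n =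
      (W⁄k).toAffine.negY a (b ^ Fintype.card F ^ n) := by
  obtain ⟨ψ, hψ⟩ := exists_algHom_eq_pow (F := F) (k := k) n
  have h := Affine.baseChange_negY (W' := W) ψ a b
  rwa [hψ, hψ, hψ, ha, eq_comm] at h

open scoped Classical in
omit [W.IsElliptic] [IsAlgClosed k] in
-- The ordinates above a are b and its conjugate, and the Q-power map permutes them: it fixes both
-- or swaps them.
lemma card_fixedOrdinates {n : ℕ} (hQ : 1 < Fintype.card F ^ n) {a b : k}
    (hab : (W⁄k).toAffine.Equation a b) (ha : a ^ Fintype.card F ^ n = a) :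
    (fixedOrdinates (W⁄k) (Fintype.card F ^ n) a).card =
      if b = (W⁄k).toAffine.negY a b then 1 else
        if b ^ Fintype.card F ^ n = b then 2 else 0 := by
  have hmem (z : k) : z ∈ fixedOrdinates (W⁄k) (Fintype.card F ^ n) a ↔
      z ^ Fintype.card F ^ n = z ∧ (z = b ∨ z = (W⁄k).toAffine.negY a b) := by
    rw [fixedOrdinates, Finset.mem_filter, mem_fixedElements hQ]
    refine and_congr_right fun _ ↦ ⟨fun h ↦ Affine.Y_eq_of_X_eq h hab rfl, ?_⟩
    rintro (rfl | rfl)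
    · exact hab
    · exact (Affine.equation_neg _ _).mpr hab
  have hb := pow_eq_or_of_equation hab ha
  have hb' := negY_pow (W := W) b ha
  split_ifs with h1 h2
  · rw [Finset.card_eq_one]
    refine ⟨b, ?_⟩
    ext z
    rw [hmem, ← h1, or_self, Finset.mem_singleton]
    rw [← h1, or_self] at hb
    constructor
    · exact fun h ↦ h.2
    · rintro rfl; exact ⟨hb, rfl⟩
  · rw [Finset.card_eq_two]
    refine ⟨b, _, h1, ?_⟩
    ext z
    rw [hmem, Finset.mem_insert, Finset.mem_singleton]
    refine ⟨fun h ↦ h.2, fun h ↦ ⟨?_, h⟩⟩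
    rcases h with rfl | rfl
    · exact h2
    · rw [hb', h2]
  · rw [Finset.card_eq_zero, Finset.eq_empty_iff_forall_notMem]
    intro z hz
    rw [hmem] at hz
    have h3 := hb.resolve_left h2
    rcases hz with ⟨h4, rfl | rfl⟩
    · exact h2 h4
    · rw [hb', h3, Affine.negY_negY] at h4
      exact h1 h4

section Reps

variable {n : ℕ} {u₃ u₄ : Fin 2 → k[X]}
    (h₃ : IsXRep ((frobeniusHom W k)^[n] (oddGeneralPoint W k) + oddGeneralPoint W k).1 u₃)
    (h₄ : IsXRep ((frobeniusHom W k)^[n] (oddGeneralPoint W k) - oddGeneralPoint W k).1 u₄)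

include h₃ h₄

lemma exists_addSubVec_frobenius_eq : ∃ c : k, c ≠ 0 ∧ ∀ i,
    addSubVec ((W⁄k).map C) (symSq ![X ^ Fintype.card F ^ n, 1] ![X, 1]) i =
      C c * symSq u₃ u₄ i :=
  IsXRep.addSubVec_eq (isXRep_frobeniusHom_iterate n) isXRep_generalPoint h₃ h₄

/-- The multiplicities of the poles of the abscissa of `φⁿ - 1`. -/
lemma rootMultiplicity_eq_card (hn : n ≠ 0) {a : k} (ha : a ^ Fintype.card F ^ n = a) :
    rootMultiplicity a (u₄ 1) = (fixedOrdinates (W⁄k) (Fintype.card F ^ n) a).card := by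
  classical
  have hQ : 1 < Fintype.card F ^ n := Nat.one_lt_pow hn Fintype.one_lt_card
  obtain ⟨c, hc, hsq⟩ := exists_addSubVec_frobenius_eq h₃ h₄
  obtain ⟨h₁, hφ⟩ := frobeniusHom_iterate_eq (W := W) (k := k) n
  set Q := Fintype.card F ^ n with hQdef
  have hA2 : (X ^ Q - X : k[X]) ^ 2 = C c * (u₃ 1 * u₄ 1) := by
    refine Eq.trans ?_ (hsq 2)
    simp [addSubVec, symSq]; ring
  obtain ⟨b, hab⟩ : ∃ b : k, (W⁄k).toAffine.Equation a b := by
    obtain ⟨b, hb⟩ := IsAlgClosed.exists_root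
      (C 1 * X ^ 2 + C (algebraMap F k W.a₁ * a + algebraMap F k W.a₃) * X +
        C (-(a ^ 3 + algebraMap F k W.a₂ * a ^ 2 + algebraMap F k W.a₄ * a +
          algebraMap F k W.a₆))) (by rw [degree_quadratic one_ne_zero]; decide)
    refine ⟨b, (Affine.equation_baseChange_iff W a b).mpr ?_⟩
    rw [IsRoot.def] at hb
    simp only [eval_add, eval_mul, eval_C, eval_pow, eval_X] at hb
    linear_combination hb
  have hab' : ((W⁄k)⁄k).toAffine.Equation a b := FunField.equation_baseChange hab
  have hA1 : c * ((u₃ 0).eval a * (u₄ 1).eval a + (u₃ 1).eval a * (u₄ 0).eval a) =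
      (b - (W⁄k).toAffine.negY a b) ^ 2 := by
    have h := congrArg (eval a) (hsq 1)
    rw [Affine.equation_baseChange_iff] at hab
    simp [addSubVec, symSq, ha, b₂, b₄, b₆] at h
    rw [← h]
    change _ = (b - (-b - algebraMap F k W.a₁ * a - algebraMap F k W.a₃)) ^ 2
    linear_combination (-4) * hab
  -- X^Q - X is separable, so the double zero of its square at a is shared between the denominators
  -- of φⁿe + e and φⁿe - e.
  have hmul : rootMultiplicity a (u₃ 1) + rootMultiplicity a (u₄ 1) = 2 := by
    obtain ⟨p, _, m, hp, hm⟩ := FiniteField.card' F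
    have : CharP k p := charP_of_injective_algebraMap' F p
    have hdvd : p ∣ Q := by
      rw [hQdef, hm]
      exact dvd_pow (dvd_pow_self p m.ne_zero) hn
    have h := rootMultiplicity_X_pow_sub_X_sq hdvd hQ ha
    have hne : C c * (u₃ 1 * u₄ 1) ≠ 0 := by
      rw [← hA2]
      exact pow_ne_zero 2 (FiniteField.X_pow_card_sub_X_ne_zero k hQ)
    rwa [hA2, rootMultiplicity_mul hne, rootMultiplicity_mul (right_ne_zero_of_mul hne),
      rootMultiplicity_C, zero_add] at h
  have hY : Affine.FunctionField.evalRing hab' (Affine.CoordinateRing.mk _ X) = b :=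
    Affine.FunctionField.evalRing_mk_Y hab'
  have hs₁ : FunField.ofRing W k (Affine.CoordinateRing.mk _ X ^ Q) = FunField.y W k ^ Q := by
    rw [_root_.map_pow, FunField.ofRing_mk_Y]
  have hxy := (Affine.equation_iff_nonsingular (W := W⁄(FunField W k))).mp
    (FunField.equation_x_y W k)
  have hxy' := (Affine.nonsingular_neg _ _).mpr hxy
  -- The addition formula, cleared of denominators, at (a, b): a zero of u₄ 1 forces b^Q = b. The
  -- next identity shows that a zero of u₃ 1 forces b^Q to be the conjugate of b.
  have hp : c * ((u₃ 0).eval a * (u₄ 1).eval a) = (b ^ Q - b) ^ 2 := by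
    have h₃' : IsXRep (Point.some _ _ h₁ + Point.some _ _ hxy) u₃ := by rw [← hφ]; exact h₃
    have h := eval_mul_eq_of_isXRep_add hQ hs₁ (FunField.ofRing_mk_Y W k) h₃' hA2 hab' ha
    rwa [_root_.map_pow, hY] at h
  have hm : c * ((u₄ 0).eval a * (u₃ 1).eval a) = (b ^ Q - (W⁄k).toAffine.negY a b) ^ 2 := by
    have h₄' : IsXRep (Point.some _ _ h₁ + Point.some _ _ hxy') u₄ := by
      rw [← hφ, ← Point.neg_some hxy, ← sub_eq_add_neg]; exact h₄
    have hs₂ : FunField.ofRing W k (-Affine.CoordinateRing.mk _ X -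
        algebraMap k[X] _ (C (algebraMap F k W.a₁) * X + C (algebraMap F k W.a₃))) =
        (W⁄(FunField W k)).toAffine.negY (FunField.x W k) (FunField.y W k) := by
      have hF (r : F) : algebraMap F (FunField W k) r =
          algebraMap k[X] (FunField W k) (C (algebraMap F k r)) :=
        IsScalarTower.algebraMap_apply F k[X] (FunField W k) r
      change _ = -FunField.y W k - algebraMap F (FunField W k) W.a₁ * FunField.x W k -
        algebraMap F (FunField W k) W.a₃
      rw [_root_.map_sub, _root_.map_neg, FunField.ofRing_mk_Y, FunField.ofRing_algebraMap, hF, hF,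
        _root_.map_add, _root_.map_mul, FunField.algebraMap_X]
      ring
    have h := eval_mul_eq_of_isXRep_add hQ hs₁ hs₂ h₄' (by rw [hA2, mul_comm (u₃ 1)]) hab' ha
    rw [_root_.map_pow, _root_.map_sub, _root_.map_neg, hY,
      Affine.FunctionField.evalRing_algebraMap] at h
    rw [h]
    congr 2
    change _ = -b - algebraMap F k W.a₁ * a - algebraMap F k W.a₃
    simp
    ring
  have hzero {f : k[X]} (hf : f.eval a ≠ 0) : rootMultiplicity a f = 0 :=
    rootMultiplicity_eq_zero hf
  rw [card_fixedOrdinates hQ hab ha]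
  have hu₃ : (fun i ↦ (u₃ i).eval a) ≠ 0 := Function.ne_iff.mpr (h₃.1 a)
  have hu₄ : (fun i ↦ (u₄ i).eval a) ≠ 0 := Function.ne_iff.mpr (h₄.1 a)
  -- If b is its own conjugate, both denominators vanish at a, once each. Otherwise the double zero
  -- belongs entirely to u₄ 1 when b^Q = b, and to u₃ 1 when the ordinates are swapped.
  split_ifs with hb1 hb2
  · rw [← hb1, sub_self, zero_pow two_ne_zero] at hA1
    have hA2' := congrArg (eval a) hA2
    simp only [eval_pow, eval_sub, eval_X, ha, sub_self, eval_mul, eval_C] at hA2'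
    obtain ⟨h5, h6⟩ := symSq_eq_zero hu₃ hu₄ ((mul_eq_zero_iff_left hc).mp hA1)
      ((mul_eq_zero_iff_left hc).mp (hA2'.symm.trans (zero_pow two_ne_zero)))
    have hne : u₃ 1 ≠ 0 ∧ u₄ 1 ≠ 0 := by
      constructor
      all_goals
        intro h0
        rw [h0] at hA2
        simp only [mul_zero, zero_mul] at hA2
        exact pow_ne_zero 2 (FiniteField.X_pow_card_sub_X_ne_zero k hQ) hA2
    have h7 := (rootMultiplicity_pos hne.1).mpr h5
    have h8 := (rootMultiplicity_pos hne.2).mpr h6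
    omega
  · have h5 : (u₃ 1).eval a ≠ 0 := by
      intro h0
      rw [h0, hb2, mul_zero, mul_zero, eq_comm] at hm
      exact hb1 (sub_eq_zero.mp (pow_eq_zero_iff two_ne_zero |>.mp hm))
    rw [hzero h5] at hmul
    omega
  · refine hzero fun h0 ↦ hb2 ?_
    rw [h0, mul_zero, mul_zero, eq_comm] at hp
    exact sub_eq_zero.mp (pow_eq_zero_iff two_ne_zero |>.mp hp)

/-- The abscissa has a simple pole at infinity. The value at infinity of the symmetric square is
proportional to (1, 0, 0), so both u₃ 1 and u₄ 1 fall below the maximal degrees. These add up to 2Q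
+ 2 while the degrees of u₃ 1 and u₄ 1 add up to 2Q, so each drop is exactly one. -/
lemma maxDegree_eq_natDegree_add_one (hn : n ≠ 0) :
    maxDegree u₄ = (u₄ 1).natDegree + 1 := by
  have hQ : 1 < Fintype.card F ^ n := Nat.one_lt_pow hn Fintype.one_lt_card
  obtain ⟨c, hc, hsq⟩ := exists_addSubVec_frobenius_eq h₃ h₄
  set Q := Fintype.card F ^ n with hQdef
  have hA2 : (X ^ Q - X : k[X]) ^ 2 = C c * (u₃ 1 * u₄ 1) := by
    refine Eq.trans ?_ (hsq 2)
    simp [addSubVec, symSq]; ring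
  have hne0 : C c * (u₃ 1 * u₄ 1) ≠ 0 := by
    rw [← hA2]
    exact pow_ne_zero 2 (FiniteField.X_pow_card_sub_X_ne_zero k hQ)
  have hne := mul_ne_zero_iff.mp (right_ne_zero_of_mul hne0)
  have htop₁ (i : Fin 2) : ((![X ^ Q, 1] : Fin 2 → k[X]) i).HasTop Q (![1, 0] i) := by
    fin_cases i
    · exact ⟨by simp, by simp⟩
    · exact ⟨by simp, by simp [coeff_one]; omega⟩
  have htop₂ (i : Fin 2) : ((![X, 1] : Fin 2 → k[X]) i).HasTop 1 (![1, 0] i) := by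
    fin_cases i
    · exact ⟨by simp, by simp⟩
    · exact ⟨by simp, by simp [coeff_one]⟩
  have h10 : (![1, 0] : Fin 2 → k) ≠ 0 := Function.ne_iff.mpr ⟨0, by simp⟩
  have hH : maxDegree u₃ + maxDegree u₄ = 2 * (Q + 1) := by
    have h := IsXRep.maxDegree_add (isXRep_frobeniusHom_iterate n) isXRep_generalPoint h₃ h₄
    rw [maxDegree_eq htop₁ h10, maxDegree_eq htop₂ h10] at h
    omega
  have htopA (i) := hasTop_addSubVec (W⁄k) (hasTop_symSq htop₁ htop₂) i
  have htopB (i) := (hasTop_symSq (hasTop_maxDegree u₃) (hasTop_maxDegree u₄) i).C_mul c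
  have hcoeff (i) : addSubVec (W⁄k) (symSq ![1, 0] ![1, 0]) i =
      c * symSq (fun j ↦ (u₃ j).coeff (maxDegree u₃)) (fun j ↦ (u₄ j).coeff (maxDegree u₄)) i := by
    rw [← (htopA i).2, ← (htopB i).2, hsq, hH]
  have h1 := hcoeff 1
  have h2 := hcoeff 2
  simp only [addSubVec, symSq, Matrix.cons_val_zero, Matrix.cons_val_one, Matrix.cons_val] at h1 h2
  obtain ⟨h5, h6⟩ := symSq_eq_zero (coeff_maxDegree_ne_zero h₃.1.ne_zero)
    (coeff_maxDegree_ne_zero h₄.1.ne_zero) ((mul_eq_zero_iff_left hc).mp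
      (h1.symm.trans (by ring))) ((mul_eq_zero_iff_left hc).mp (h2.symm.trans (by ring)))
  have hlt {f : k[X]} {D : ℕ} (hf : f ≠ 0) (hle : f.natDegree ≤ D) (h0 : f.coeff D = 0) :
      f.natDegree < D := by
    refine lt_of_le_of_ne hle fun h ↦ hf ?_
    rw [← h] at h0
    exact leadingCoeff_eq_zero.mp h0
  have h7 := hlt hne.1 (natDegree_le_maxDegree u₃ 1) h5
  have h8 := hlt hne.2 (natDegree_le_maxDegree u₄ 1) h6
  have h9 := congrArg natDegree hA2
  rw [natDegree_pow, FiniteField.X_pow_card_sub_X_natDegree_eq k hQ, natDegree_C_mul hc,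
    natDegree_mul hne.1 hne.2] at h9
  omega

end Reps

/-- The degree of a rational function is its number of poles. The finite ones are counted with
multiplicity by the rational ordinates above each fixed a; the summand 1 is the pole at infinity. -/
theorem oddDegree_frobeniusHom_iterate_sub {n : ℕ} (hn : n ≠ 0) :
    oddDegree W k ((frobeniusHom W k)^[n] (oddGeneralPoint W k) - oddGeneralPoint W k) =
    ∑ a ∈ fixedElements k (Fintype.card F ^ n),
      (fixedOrdinates (W⁄k) (Fintype.card F ^ n) a).card + 1 := by
  classical
  have hQ : 1 < Fintype.card F ^ n := Nat.one_lt_pow hn Fintype.one_lt_card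
  obtain ⟨u₃, h₃⟩ := exists_isXRep
    ((frobeniusHom W k)^[n] (oddGeneralPoint W k) + oddGeneralPoint W k).2
  obtain ⟨u₄, h₄⟩ := exists_isXRep
    ((frobeniusHom W k)^[n] (oddGeneralPoint W k) - oddGeneralPoint W k).2
  rw [oddDegree, h₄.xDegree_eq, maxDegree_eq_natDegree_add_one h₃ h₄ hn]
  obtain ⟨c, hc, hsq⟩ := exists_addSubVec_frobenius_eq h₃ h₄
  have hA2 : (X ^ Fintype.card F ^ n - X : k[X]) ^ 2 = C c * (u₃ 1 * u₄ 1) := by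
    refine Eq.trans ?_ (hsq 2)
    simp [addSubVec, symSq]; ring
  have hroot : ∀ a ∈ (u₄ 1).roots, a ∈ fixedElements k (Fintype.card F ^ n) := by
    intro a ha
    have h := congrArg (eval a) hA2
    rw [eval_mul, eval_mul, (isRoot_of_mem_roots ha).eq_zero, mul_zero, mul_zero, eval_pow] at h
    rw [mem_fixedElements hQ]
    simpa [sub_eq_zero] using h
  rw [← IsAlgClosed.card_roots_eq_natDegree, ← Multiset.sum_count_eq_card hroot]
  push_cast
  congr 1
  refine Finset.sum_congr rfl fun a ha ↦ ?_
  rw [count_roots, rootMultiplicity_eq_card h₃ h₄ hn ((mem_fixedElements hQ).mp ha)]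

end FrobeniusSub

/-! ### Point counts over finite extensions and the trace sequence. -/

section PointCount

variable {F : Type*} [Field F] [Fintype F] {W : WeierstrassCurve F} [W.IsElliptic]

lemma card_fixedElements_le {k : Type*} [Field k] {Q : ℕ} (hQ : 1 < Q) :
    (fixedElements k Q).card ≤ Q := by
  classical
  refine (Multiset.toFinset_card_le _).trans ((card_roots' _).trans ?_)
  rw [FiniteField.X_pow_card_sub_X_natDegree_eq k hQ]

omit [Fintype F] in
lemma fixedElements_eq_map {k : Type*} [Field k] [Algebra F k] {L : Type*} [Field L] [Fintype L]
    [Algebra F L] (ι : L →ₐ[F] k) :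
    fixedElements k (Fintype.card L) =
      Finset.univ.map ⟨ι, ι.injective⟩ := by
  have hQ : 1 < Fintype.card L := Fintype.one_lt_card
  refine (Finset.eq_of_subset_of_card_le ?_ ?_).symm
  · intro a ha
    obtain ⟨z, -, rfl⟩ := Finset.mem_map.mp ha
    rw [mem_fixedElements hQ]
    change ι z ^ _ = ι z
    rw [← _root_.map_pow, FiniteField.pow_card]
  · rw [Finset.card_map, Finset.card_univ]
    exact card_fixedElements_le hQ

omit [Fintype F] in
lemma natCard_point_eq {k : Type*} [Field k] [Algebra F k] {L : Type*} [Field L] [Fintype L]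
    [Algebra F L] (ι : L →ₐ[F] k) :
    Nat.card (W⁄L).toAffine.Point =
      ∑ a ∈ fixedElements k (Fintype.card L),
        (fixedOrdinates (W⁄k) (Fintype.card L) a).card + 1 := by
  classical
  have hord (z : L) : (fixedOrdinates (W⁄k) (Fintype.card L) (ι z)).card =
      Nat.card {w : L // (W⁄L).toAffine.Equation z w} := by
    rw [Nat.card_eq_fintype_card, Fintype.card_subtype, fixedOrdinates, fixedElements_eq_map ι,
      Finset.filter_map, Finset.card_map]
    congr 2
    ext w
    exact Affine.baseChange_equation (W := W) ι.injective z w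
  have hW : (W⁄L).IsElliptic := inferInstanceAs (W.map _).IsElliptic
  rw [Nat.card_congr (Affine.pointEquiv (W⁄L).toAffine)]
  change Nat.card (Option _) = _
  rw [Finite.card_option, Nat.card_congr (Equiv.subtypeProdEquivSigmaSubtype _), Nat.card_sigma,
    fixedElements_eq_map ι, Finset.sum_map]
  congr 1
  exact Finset.sum_congr rfl fun z _ ↦ (hord z).symm

variable (W) in
/-- The traces of the powers of Frobenius: they satisfy a linear recurrence and the Hasse bound. -/
theorem exists_trace_sequence : ∃ b : ℕ → ℤ, b 0 = 2 ∧
    (∀ n, b (n + 2) = b 1 * b (n + 1) - Fintype.card F * b n) ∧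
    b 1 ^ 2 ≤ 4 * Fintype.card F ∧
    ∀ n ≠ 0, ∀ (L : Type) [Field L] [Fintype L] [Algebra F L],
      Fintype.card L = Fintype.card F ^ n →
      (Nat.card (W⁄L).toAffine.Point : ℤ) = (Fintype.card F : ℤ) ^ n + 1 - b n := by
  classical
  let k := AlgebraicClosure F
  let e := oddGeneralPoint W k
  let φ := frobeniusHom W k
  have hd := parallelogramLaw_oddDegree (W := W) (k := k)
  have h0 := oddDegree_nonneg W k
  have he : oddDegree W k e = 1 := oddDegree_oddGeneralPoint W k
  have hφ := oddDegree_frobeniusHom (W := W) (k := k)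
  refine ⟨fun n ↦ hd.polarHom e (φ^[n] e), ?_, ?_, ?_, ?_⟩
  · change hd.polarHom e e = 2
    rw [hd.polarHom_self, he, mul_one]
  · exact hd.polarHom_recurrence h0 hφ he oddDegree_frobenius_sq_sub
  · exact hd.sq_polarHom_le h0 hφ he
  · intro n hn L _ _ _ hL
    have : FiniteDimensional F L := Module.Finite.of_finite
    let ι : L →ₐ[F] k := IsAlgClosed.lift
    rw [natCard_point_eq ι, hL, ← hd.map_iterate_sub hφ he,
      oddDegree_frobeniusHom_iterate_sub hn]
    push_cast
    rfl

end PointCount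

/-! ### A p-torsion point forces p to divide some point count. -/

section Torsion

variable {p : ℕ} [Fact p.Prime] {W : WeierstrassCurve (ZMod p)}

/-- Two algebraic elements generate a finite field, whose degree serves as n. -/
lemma exists_pow_card_eq {k : Type*} [Field k] [Algebra (ZMod p) k]
    [Algebra.IsAlgebraic (ZMod p) k] (x y : k) :
    ∃ n ≠ 0, x ^ p ^ n = x ∧ y ^ p ^ n = y := by
  let L := IntermediateField.adjoin (ZMod p) {x, y}
  have : FiniteDimensional (ZMod p) L :=
    IntermediateField.finiteDimensional_adjoin fun z _ ↦ Algebra.IsIntegral.isIntegral z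
  have : Finite L := Module.finite_of_finite (ZMod p)
  have : Fintype L := Fintype.ofFinite L
  have hc : Fintype.card L = p ^ Module.finrank (ZMod p) L := by
    rw [← Nat.card_eq_fintype_card, Module.natCard_eq_pow_finrank (K := ZMod p), Nat.card_zmod]
  refine ⟨Module.finrank (ZMod p) L, Module.finrank_pos.ne', ?_, ?_⟩
  · have h := FiniteField.pow_card (⟨x, IntermediateField.subset_adjoin _ _ (by simp)⟩ : L)
    rw [hc] at h
    exact congrArg Subtype.val h
  · have h := FiniteField.pow_card (⟨y, IntermediateField.subset_adjoin _ _ (by simp)⟩ : L)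
    rw [hc] at h
    exact congrArg Subtype.val h

lemma exists_dvd_natCard_point {k : Type*} [Field k] [Algebra (ZMod p) k] [IsAlgClosed k]
    [Algebra.IsAlgebraic (ZMod p) k] [DecidableEq k] {P : (W⁄k).toAffine.Point} (hP : P ≠ 0)
    (h : p • P = 0) : ∃ n ≠ 0, p ∣ Nat.card (W⁄(GaloisField p n)).toAffine.Point := by
  classical
  rcases P with _ | ⟨x, y, hxy⟩
  · exact absurd rfl hP
  obtain ⟨n, hn, hx, hy⟩ := exists_pow_card_eq (p := p) x y
  refine ⟨n, hn, ?_⟩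
  have : Fintype (GaloisField p n) := Fintype.ofFinite _
  have hc : Fintype.card (GaloisField p n) = p ^ n := by
    rw [← Nat.card_eq_fintype_card, GaloisField.card p n hn]
  have : FiniteDimensional (ZMod p) (GaloisField p n) := Module.Finite.of_finite
  let ι : GaloisField p n →ₐ[ZMod p] k := IsAlgClosed.lift
  have hQ : 1 < p ^ n := Nat.one_lt_pow hn (Fact.out : p.Prime).one_lt
  have hmem {z : k} (hz : z ^ p ^ n = z) : ∃ w, ι w = z := by
    have : z ∈ fixedElements k (Fintype.card (GaloisField p n)) := by
      rw [hc, mem_fixedElements hQ, hz]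
    rw [fixedElements_eq_map ι] at this
    obtain ⟨w, -, hw⟩ := Finset.mem_map.mp this
    exact ⟨w, hw⟩
  obtain ⟨x', rfl⟩ := hmem hx
  obtain ⟨y', rfl⟩ := hmem hy
  have hxy' := (Affine.baseChange_nonsingular (W := W) ι.injective _ _).mp hxy
  let P' : (W⁄(GaloisField p n)).toAffine.Point := .some x' y' hxy'
  have hmap : Point.map ι P' = .some _ _ hxy := rfl
  have hord : addOrderOf P' = p := by
    refine addOrderOf_eq_prime ?_ (Point.some_ne_zero _)
    apply Point.map_injective (W' := W) ι
    rw [_root_.map_nsmul, hmap, h, _root_.map_zero]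
  have hdvd := addOrderOf_dvd_natCard P'
  rwa [hord] at hdvd

end Torsion

end EllipticCurves

/-! ### Density and mean square of cos(nθ). -/

section Rotation

open Filter Topology

/-- All integer multiples of θ are dense on the circle. Evenness of cosine folds the negative ones
onto the positive ones, and the zero multiple contributes only the value 1, which is recovered as a
limit point of [-1, 1). -/
theorem Icc_subset_closure_image_cos {θ : ℝ} (h : Irrational (θ / (2 * Real.pi))) :
    Set.Icc (-1 : ℝ) 1 ⊆ closure ((fun n : ℕ ↦ Real.cos (n * θ)) '' {n | 1 ≤ n}) := by
  set S := (fun n : ℕ ↦ Real.cos (n * θ)) '' {n | 1 ≤ n}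
  have hd : DenseRange (fun z : ℤ ↦ (z • (θ : Real.Angle))) :=
    AddCircle.denseRange_zsmul_coe_iff.mpr h
  have key : Set.Icc (-1 : ℝ) 1 ⊆ {1} ∪ closure S := by
    intro x hx
    have hx' : x ∈ Real.Angle.cos '' closure (Set.range fun z : ℤ ↦ (z • (θ : Real.Angle))) :=
      ⟨(Real.arccos x : Real.Angle), hd _, by
        rw [Real.Angle.cos_coe, Real.cos_arccos hx.1 hx.2]⟩
    have hx'' := image_closure_subset_closure_image Real.Angle.continuous_cos hx'
    have hsub : Real.Angle.cos '' (Set.range fun z : ℤ ↦ (z • (θ : Real.Angle))) ⊆ {1} ∪ S := by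
      rintro _ ⟨_, ⟨z, rfl⟩, rfl⟩
      have hz : Real.Angle.cos (z • (θ : Real.Angle)) = Real.cos (z.natAbs * θ) := by
        rw [← Real.Angle.coe_zsmul, Real.Angle.cos_coe, zsmul_eq_mul, Nat.cast_natAbs]
        rcases abs_choice z with h | h <;> simp [h]
      rcases Nat.eq_zero_or_pos z.natAbs with h0 | h0
      · left; rw [hz, h0]; simp
      · right; exact ⟨_, h0, hz.symm⟩
    have := closure_mono hsub hx''
    rwa [closure_union, closure_singleton] at this
  have hIco : Set.Ico (-1 : ℝ) 1 ⊆ closure S := fun x hx ↦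
    (key ⟨hx.1, hx.2.le⟩).resolve_left fun h ↦ hx.2.ne h
  rw [← closure_Ico (by norm_num : (-1 : ℝ) ≠ 1)]
  exact closure_minimal hIco isClosed_closure

theorem two_mul_sin_mul_sum_cos (θ : ℝ) (N : ℕ) :
    2 * Real.sin θ * ∑ n ∈ Finset.Icc 1 N, Real.cos (2 * (n * θ)) =
      Real.sin ((2 * N + 1) * θ) - Real.sin θ := by
  induction N with
  | zero => simp
  | succ N ih =>
    rw [Finset.sum_Icc_succ_top (by omega), mul_add, ih]
    have h₁ : (2 * ((N + 1 : ℕ) : ℝ) + 1) * θ = 2 * ((N + 1 : ℕ) * θ) + θ := by ring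
    have h₂ : (2 * (N : ℝ) + 1) * θ = 2 * ((N + 1 : ℕ) * θ) - θ := by push_cast; ring
    rw [h₁, h₂, Real.sin_add, Real.sin_sub]
    ring

/-- By the double angle formula the deviation from N / 2 is half of a telescoping cosine sum,
bounded by 1 / |sin θ|. -/
theorem half_sub_le_sum_cos_sq {θ : ℝ} (h : Real.sin θ ≠ 0) (N : ℕ) :
    (N : ℝ) / 2 - 1 / (2 * |Real.sin θ|) ≤ ∑ n ∈ Finset.Icc 1 N, Real.cos (n * θ) ^ 2 := by
  have h₁ : ∑ n ∈ Finset.Icc 1 N, Real.cos (n * θ) ^ 2 =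
      (N : ℝ) / 2 + (∑ n ∈ Finset.Icc 1 N, Real.cos (2 * (n * θ))) / 2 := by
    simp only [Real.cos_sq, Finset.sum_add_distrib, Finset.sum_div]
    simp
    ring
  set T := ∑ n ∈ Finset.Icc 1 N, Real.cos (2 * (n * θ))
  have hs : 0 < |Real.sin θ| := abs_pos.mpr h
  have h₂ : 2 * |Real.sin θ| * |T| ≤ 2 := by
    rw [show 2 * |Real.sin θ| * |T| = |2 * Real.sin θ * T| by rw [abs_mul, abs_mul, abs_two],
      two_mul_sin_mul_sum_cos]
    refine (abs_sub _ _).trans ?_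
    linarith [Real.abs_sin_le_one θ, Real.abs_sin_le_one ((2 * N + 1) * θ)]
  have h₃ : |T| ≤ 1 / |Real.sin θ| := by
    rw [le_div_iff₀ hs]; linarith
  have h₄ : 1 / (2 * |Real.sin θ|) = 1 / |Real.sin θ| / 2 := by
    field_simp
  rw [h₁, h₄]
  linarith [neg_abs_le T]

/-- Equidistribution would bound the mean of cos²(nθ) by an upper Riemann sum of x², namely 15/32,
which is below the actual mean 1/2. -/
theorem not_isEquidistributed_of_eq_cos {θ : ℝ} (h : Real.sin θ ≠ 0) {u : ℕ → ℝ}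
    (hu : ∀ n, 1 ≤ n → u n = Real.cos (n * θ)) :
    ¬ FrobeniusTraces.IsEquidistributed u (-1) 1 := by
  classical
  intro he
  let A (t : ℝ) (N : ℕ) : ℝ := ((Finset.Icc 1 N).filter (fun n ↦ u n ∈ Set.Icc (-t) t)).card
  have hA (t : ℝ) (h₀ : 0 ≤ t) (h₁ : t ≤ 1) : Tendsto (fun N ↦ A t N / N) atTop (𝓝 t) := by
    have := he (-t) t (by linarith) (by linarith) h₁
    rw [show (t - -t) / (1 - -1) = t by ring] at this
    convert this
  -- The step function takes the values 1/16, 1/4, 9/16, 1 on the successive quarters of |x|; the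
  -- coefficients are their differences.
  have hstep (x : ℝ) (hx : |x| ≤ 1) : x ^ 2 ≤
      1 - 7 / 16 * (if x ∈ Set.Icc (-(3 / 4)) (3 / 4) then 1 else 0)
        - 5 / 16 * (if x ∈ Set.Icc (-(1 / 2)) (1 / 2) then 1 else 0)
        - 3 / 16 * (if x ∈ Set.Icc (-(1 / 4)) (1 / 4) then 1 else 0) := by
    simp only [Set.mem_Icc, ← abs_le]
    rw [← sq_abs]
    have := abs_nonneg x
    split_ifs <;> nlinarith
  have hupper (N : ℕ) : ∑ n ∈ Finset.Icc 1 N, Real.cos (n * θ) ^ 2 ≤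
      N - 7 / 16 * A (3 / 4) N - 5 / 16 * A (1 / 2) N - 3 / 16 * A (1 / 4) N := by
    have : ∑ n ∈ Finset.Icc 1 N, Real.cos (n * θ) ^ 2 ≤ ∑ n ∈ Finset.Icc 1 N,
        (1 - 7 / 16 * (if u n ∈ Set.Icc (-(3 / 4)) (3 / 4) then 1 else 0)
        - 5 / 16 * (if u n ∈ Set.Icc (-(1 / 2)) (1 / 2) then 1 else 0)
        - 3 / 16 * (if u n ∈ Set.Icc (-(1 / 4)) (1 / 4) then (1 : ℝ) else 0)) := by
      refine Finset.sum_le_sum fun n hn ↦ ?_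
      rw [hu n (Finset.mem_Icc.mp hn).1]
      exact hstep _ (Real.abs_cos_le_one _)
    refine this.trans_eq ?_
    simp only [Finset.sum_sub_distrib, ← Finset.mul_sum, Finset.sum_boole, A]
    simp
  have hlim : Tendsto (fun N : ℕ ↦ 1 - 7 / 16 * (A (3 / 4) N / N) - 5 / 16 * (A (1 / 2) N / N)
      - 3 / 16 * (A (1 / 4) N / N) + 1 / (2 * |Real.sin θ|) / N) atTop
      (𝓝 (1 - 7 / 16 * (3 / 4) - 5 / 16 * (1 / 2) - 3 / 16 * (1 / 4) + 0)) :=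
    ((((tendsto_const_nhds.sub ((hA _ (by norm_num) (by norm_num)).const_mul _)).sub
      ((hA _ (by norm_num) (by norm_num)).const_mul _)).sub
      ((hA _ (by norm_num) (by norm_num)).const_mul _))).add
      (tendsto_const_div_atTop_nhds_zero_nat _)
  have hge : ∀ᶠ N : ℕ in atTop, (1 / 2 : ℝ) ≤ 1 - 7 / 16 * (A (3 / 4) N / N)
      - 5 / 16 * (A (1 / 2) N / N) - 3 / 16 * (A (1 / 4) N / N)
      + 1 / (2 * |Real.sin θ|) / N := by
    filter_upwards [eventually_ge_atTop 1] with N hN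
    have hN' : (0 : ℝ) < N := by exact_mod_cast hN
    have := (half_sub_le_sum_cos_sq h N).trans (hupper N)
    have h₂ := div_le_div_of_nonneg_right (sub_nonneg.mpr this) hN'.le
    rw [zero_div] at h₂
    have h₃ : ((N : ℝ) - 7 / 16 * A (3 / 4) N - 5 / 16 * A (1 / 2) N - 3 / 16 * A (1 / 4) N -
        ((N : ℝ) / 2 - 1 / (2 * |Real.sin θ|))) / N = 1 - 7 / 16 * (A (3 / 4) N / N)
        - 5 / 16 * (A (1 / 2) N / N) - 3 / 16 * (A (1 / 4) N / N)
        + 1 / (2 * |Real.sin θ|) / N - 1 / 2 := by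
      generalize 1 / (2 * |Real.sin θ|) = K
      field_simp
      ring
    linarith
  have := ge_of_tendsto hlim hge
  norm_num at this

end Rotation

/-! ### Power sums of the eigenvalues, their residues mod p, and irrationality of the angle. -/

section Recurrence

theorem eq_pow_add_conj_pow {b : ℕ → ℤ} {q : ℕ} {τ : ℂ} (h₀ : b 0 = 2)
    (hb : ∀ n, b (n + 2) = b 1 * b (n + 1) - q * b n)
    (hadd : τ + starRingEnd ℂ τ = b 1) (hmul : τ * starRingEnd ℂ τ = q) (n : ℕ) :
    (b n : ℂ) = τ ^ n + starRingEnd ℂ τ ^ n := by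
  induction n using Nat.twoStepInduction with
  | zero => rw [h₀]; norm_num
  | one => rw [pow_one, pow_one, hadd]
  | more n ih₀ ih₁ =>
    rw [hb]
    push_cast
    rw [ih₀, ih₁, ← hadd, ← hmul]
    ring

theorem modEq_pow_of_recurrence {b : ℕ → ℤ} {q : ℤ}
    (hb : ∀ n, b (n + 2) = b 1 * b (n + 1) - q * b n) {n : ℕ} (hn : n ≠ 0) :
    b n ≡ b 1 ^ n [ZMOD q] := by
  obtain ⟨n, rfl⟩ := Nat.exists_eq_succ_of_ne_zero hn
  clear hn
  induction n with
  | zero => simp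
  | succ n ih =>
    rw [hb, pow_succ']
    calc b 1 * b (n + 1) - q * b n ≡ b 1 * b (n + 1) [ZMOD q] :=
          (Int.modEq_iff_dvd.mpr ⟨b n, by ring⟩)
      _ ≡ _ [ZMOD q] := ih.mul_left _

/-- A polar form of a pair of conjugate numbers with norm `q` and trace `a`. -/
theorem exists_angle_of_sq_le {a q : ℝ} (hq : 0 < q) (h : a ^ 2 ≤ 4 * q) :
    ∃ θ ∈ Set.Icc (0 : ℝ) Real.pi, 2 * q ^ ((1 : ℝ) / 2) * Real.cos θ = a := by
  have hs : 0 < √q := Real.sqrt_pos.mpr hq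
  have habs : |a / (2 * √q)| ≤ 1 := by
    rw [abs_div, abs_of_pos (by positivity : 0 < 2 * √q), div_le_one (by positivity)]
    refine abs_le_of_sq_le_sq ?_ (by positivity)
    rw [mul_pow, Real.sq_sqrt hq.le]
    linarith
  refine ⟨Real.arccos (a / (2 * √q)), ⟨Real.arccos_nonneg _, Real.arccos_le_pi _⟩, ?_⟩
  rw [Real.cos_arccos (abs_le.mp habs).1 (abs_le.mp habs).2, ← Real.sqrt_eq_rpow]
  field_simp

theorem polar_pow_add_conj_pow (r θ : ℝ) (n : ℕ) :
    (r * Complex.exp (θ * Complex.I)) ^ n + starRingEnd ℂ (r * Complex.exp (θ * Complex.I)) ^ n =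
      ((2 * r ^ n * Real.cos (n * θ) : ℝ) : ℂ) := by
  rw [map_mul, ← Complex.exp_conj, map_mul, Complex.conj_ofReal, Complex.conj_ofReal,
    Complex.conj_I, mul_pow, mul_pow, ← Complex.exp_nat_mul, ← Complex.exp_nat_mul]
  push_cast
  rw [Complex.cos]
  ring_nf

theorem polar_mul_conj (r θ : ℝ) :
    (r * Complex.exp (θ * Complex.I)) * starRingEnd ℂ (r * Complex.exp (θ * Complex.I)) =
      ((r ^ 2 : ℝ) : ℂ) := by
  rw [Complex.mul_conj, Complex.normSq_eq_norm_sq, norm_mul, Complex.norm_exp_ofReal_mul_I,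
    mul_one, Complex.norm_real, Real.norm_eq_abs, sq_abs]

/-- If the sequence `b` with eigenvalues of modulus `√p` is prime to `p` somewhere, then the
argument of the eigenvalues is not a rational multiple of `2 π`. -/
theorem irrational_angle_div_two_pi {b : ℕ → ℤ} {p : ℕ} (hp : p.Prime) {θ : ℝ}
    (hb : ∀ n, b (n + 2) = b 1 * b (n + 1) - p * b n) {n : ℕ} (hn : n ≠ 0)
    (hpn : ¬ (p : ℤ) ∣ b n)
    (hcos : ∀ n, (b (2 * n) : ℝ) = 2 * (p : ℝ) ^ n * Real.cos ((2 * n : ℕ) * θ)) :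
    Irrational (θ / (2 * Real.pi)) := by
  rintro ⟨q, hq⟩
  have hθ : θ = q * (2 * Real.pi) := by
    rw [hq]; field_simp
  have hden : (q.den : ℝ) ≠ 0 := by exact_mod_cast q.den_ne_zero
  -- Twice the denominator makes the index even, so that the power of √p is an integral power of p.
  have h₁ : ((2 * q.den : ℕ) : ℝ) * θ = ((2 * q.num : ℤ) : ℝ) * (2 * Real.pi) := by
    rw [hθ, Rat.cast_def]; push_cast; field_simp
  have h₂ : b (2 * q.den) = 2 * (p : ℤ) ^ q.den := by
    have := hcos q.den
    rw [h₁, Real.cos_int_mul_two_pi, mul_one] at this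
    exact_mod_cast this
  have h₃ := modEq_pow_of_recurrence hb (n := 2 * q.den) (by simp [q.den_ne_zero])
  have hdvd : (p : ℤ) ∣ b (2 * q.den) := by
    rw [h₂]; exact (dvd_pow_self _ q.den_ne_zero).mul_left _
  have h₄ : (p : ℤ) ∣ b 1 :=
    (Nat.prime_iff_prime_int.mp hp).dvd_of_dvd_pow (h₃.dvd_iff.mp hdvd)
  exact hpn ((modEq_pow_of_recurrence hb hn).dvd_iff.mpr (dvd_pow h₄ hn))

end Recurrence

/-! ### The reduction of E at p, and the theorem. -/

section Reduction

open FrobeniusTraces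

theorem isElliptic_reductionMod {E : WeierstrassCurve ℚ} {p : ℕ} [Fact p.Prime]
    (h : (minimalModel E p).HasGoodReduction ℤ_[p]) : (reductionMod E p).IsElliptic := by
  have := (WeierstrassCurve.hasGoodReduction_iff_isElliptic_reduction ℤ_[p]).mp h
  unfold reductionMod
  infer_instance

theorem roots_frobeniusPolynomial {E : WeierstrassCurve ℚ} {p : ℕ} [Fact p.Prime] {τ σ : ℂ}
    (hadd : τ + σ = frobeniusTrace E p 1) (hmul : τ * σ = p) :
    (frobeniusPolynomial E p).roots = {τ, σ} := by
  have : frobeniusPolynomial E p =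
      (Polynomial.X - Polynomial.C τ) * (Polynomial.X - Polynomial.C σ) := by
    rw [frobeniusPolynomial, ← hadd, show (p : ℂ) = τ * σ from hmul.symm]
    simp only [map_add, map_mul]
    ring
  rw [this, Polynomial.roots_mul (mul_ne_zero (Polynomial.X_sub_C_ne_zero _)
    (Polynomial.X_sub_C_ne_zero _)), Polynomial.roots_X_sub_C, Polynomial.roots_X_sub_C]
  rfl

end Reduction

theorem lemma2p1 (E : WeierstrassCurve ℚ) [E.IsElliptic] (p : ℕ) [Fact p.Prime]
    (hE : FrobeniusTraces.HasGoodOrdinaryReduction E p) :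
    (∃ θ ∈ Set.Icc (0 : ℝ) Real.pi, ∃ τ : ℂ,
      τ = ((p : ℝ) ^ ((1 : ℝ) / 2) : ℝ) * Complex.exp (θ * Complex.I) ∧
      (FrobeniusTraces.frobeniusPolynomial E p).roots = {τ, starRingEnd ℂ τ} ∧
      (∀ n : ℕ, 1 ≤ n →
        (FrobeniusTraces.frobeniusTrace E p n : ℂ) = τ ^ n + (starRingEnd ℂ τ) ^ n ∧
        FrobeniusTraces.normalizedTrace E p n = Real.cos (n * θ))) ∧
    FrobeniusTraces.IsDenseInInterval (FrobeniusTraces.normalizedTrace E p) (-1) 1 ∧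
    ¬ FrobeniusTraces.IsEquidistributed (FrobeniusTraces.normalizedTrace E p) (-1) 1 := by
  classical
  obtain ⟨hgood, P, hP, hpP⟩ := hE
  have hp : p.Prime := Fact.out
  have hp₀ : (0 : ℝ) < p := by exact_mod_cast hp.pos
  have := isElliptic_reductionMod hgood
  obtain ⟨b, h₀, hb, hHasse, hcount⟩ := exists_trace_sequence (FrobeniusTraces.reductionMod E p)
  rw [ZMod.card] at hHasse hcount
  simp only [ZMod.card] at hb
  have hN (n : ℕ) (hn : n ≠ 0) : (FrobeniusTraces.pointCount E p n : ℤ) = p ^ n + 1 - b n := by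
    have : Fintype (GaloisField p n) := Fintype.ofFinite _
    exact hcount n hn (GaloisField p n)
      (by rw [← Nat.card_eq_fintype_card, GaloisField.card p n hn])
  have htr (n : ℕ) (hn : n ≠ 0) : FrobeniusTraces.frobeniusTrace E p n = b n := by
    rw [FrobeniusTraces.frobeniusTrace, hN n hn]; ring
  obtain ⟨θ, hθ, hcosθ⟩ := exists_angle_of_sq_le (a := b 1) hp₀ (by exact_mod_cast hHasse)
  set r : ℝ := (p : ℝ) ^ ((1 : ℝ) / 2) with hr
  have hr₀ : 0 < r := Real.rpow_pos_of_pos hp₀ _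
  have hr₂ : r ^ 2 = p := by
    rw [hr, ← Real.sqrt_eq_rpow, Real.sq_sqrt hp₀.le]
  set τ : ℂ := r * Complex.exp (θ * Complex.I) with hτ
  have hmul : τ * starRingEnd ℂ τ = p := by
    rw [hτ, polar_mul_conj, hr₂]; simp
  have hadd : τ + starRingEnd ℂ τ = b 1 := by
    have := polar_pow_add_conj_pow r θ 1
    rw [← hτ, pow_one, pow_one, pow_one, Nat.cast_one, one_mul, hcosθ] at this
    rw [this]; simp
  have hbC := eq_pow_add_conj_pow h₀ hb hadd hmul
  have hbR (n : ℕ) : (b n : ℝ) = 2 * r ^ n * Real.cos (n * θ) := by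
    have := (hbC n).trans (polar_pow_add_conj_pow r θ n)
    exact_mod_cast this
  have hcos (n : ℕ) (hn : 1 ≤ n) : FrobeniusTraces.normalizedTrace E p n = Real.cos (n * θ) := by
    rw [FrobeniusTraces.normalizedTrace, htr n (by omega), hbR,
      show (p : ℝ) ^ ((n : ℝ) / 2) = r ^ n by
        rw [hr, ← Real.rpow_mul_natCast hp₀.le]; congr 1; ring]
    field_simp
  -- Ordinarity enters only here: where p divides p^n + 1 - b n, it cannot divide b n, since it
  -- would then divide 1.
  have hirr : Irrational (θ / (2 * Real.pi)) := by
    obtain ⟨n, hn, hdvd⟩ := exists_dvd_natCard_point hP (by convert hpP)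
    refine irrational_angle_div_two_pi hp hb hn (fun hbn ↦ ?_) fun n ↦ by
      rw [hbR, pow_mul, hr₂]
    have h₁ : (p : ℤ) ∣ p ^ n + 1 - b n := by
      rw [← hN n hn]; exact Int.natCast_dvd_natCast.mpr hdvd
    have h₂ : (p : ℤ) ∣ 1 := by
      have := dvd_sub (dvd_add h₁ hbn) (dvd_pow_self (p : ℤ) hn)
      rwa [show (p : ℤ) ^ n + 1 - b n + b n - p ^ n = 1 by ring] at this
    exact (Nat.prime_iff_prime_int.mp hp).not_dvd_one h₂
  have hsin : Real.sin θ ≠ 0 := by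
    intro h
    obtain ⟨m, hm⟩ := Real.sin_eq_zero_iff.mp h
    refine hirr ⟨m / 2, ?_⟩
    rw [← hm]; push_cast; field_simp
  refine ⟨⟨θ, hθ, τ, rfl, ?_, fun n hn ↦ ⟨?_, hcos n hn⟩⟩, ⟨fun n hn ↦ ?_, ?_⟩,
    not_isEquidistributed_of_eq_cos hsin hcos⟩
  · exact roots_frobeniusPolynomial (by rw [hadd, htr 1 one_ne_zero]) hmul
  · rw [htr n (by omega), hbC]
  · rw [hcos n hn]; exact ⟨Real.neg_one_le_cos _, Real.cos_le_one _⟩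
  · rw [Set.image_congr (s := {n | 1 ≤ n}) hcos]
    exact Icc_subset_closure_image_cos hirr
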